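/- Let $G$ be a second-countable, locally compact (Hausdorff), unimodular, amenable group with Haar measure $\mu_G$, and let $Q\subseteq G$ be a compact symmetric neighbourhood of the identity. A *strong Følner sequence* is a sequence $(K_n)_{n\in\mathbb N}$ of compact subsets of $G$ of positive measure such that, for every nonempty compact $K\subseteq G$, $$\lim_{n\to\infty}\frac{\mu_G(K_nK\,\triangle\,K_n)}{\mu_G(K_n)}=0\quad\text{and}\quad \lim_{n\to\infty}\frac{\mu_G(K_nK\cap K_n^cK)}{\mu_G(K_n)}=0 .$$ For a discrete set $\Lambda\subseteq G$ put $$D^-(\Lambda)=\lim_{n\to\infty}\inf_{x\in G}\frac{\#(\Lambda\cap xK_n)}{\mu_G(K_n)},\qquad D^+(\Lambda)=\lim_{n\to\infty}\sup_{x\in G}\frac{\#(\Lambda\cap xK_n)}{\mu_G(K_n)},$$ where $(K_n)$ is any strong Følner sequence (the values do not depend on the choice). Let $(\pi,\mathcal H_\pi)$ be a discrete series projective representation of $G$: a strongly measurable map $\pi$ from $G$ to the unitary operators of a complex Hilbert space $\mathcal H_\pi$ with $\pi(xy)=\sigma(x,y)\pi(x)\pi(y)$ for some $\sigma:G\times G\to\mathbb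 T$, irreducible (no closed invariant subspaces other than $\{0\}$ and $\mathcal H_\pi$), and such that $\int_G|\langle g,\pi(x)g\rangle|^2\,d\mu_G(x)<\infty$ for some $g\neq0$. Its formal degree is the number $d_\pi>0$ with $$\int_G\langle f_1,\pi(x)g_1\rangle\langle\pi(x)g_2,f_2\rangle\,d\mu_G(x)=d_\pi^{-1}\langle f_1,f_2\rangle\overline{\langle g_1,g_2\rangle}\qquad\text{for all }f_1,f_2,g_1,g_2\in\mathcal H_\pi .$$ Write $V_gg(x)=\langle g,\pi(x)g\rangle$, and let $\mathcal B^2_\pi$ be the set of $g\in\mathcal H_\pi$ for which the local maximal function $x\mapsto\operatorname{ess\,sup}_{z\in Q}|V_gg(xz)|$ belongs to $L^2(G)$. For $\Lambda\subseteq G$, the family $(\pi(\lambda)g)_{\lambda\in\Lambda}$ is a frame for $\mathcal H_\pi$ if there are constants $A,B>0$ with $A\|f\|^2\le\sum_{\lambda\in\Lambda}|\langle f,\pi(\lambda)g\rangle|^2\le B\|f\|^2$ for all $f\in\mathcal H_\pi$. **Proposition.** Let $\Lambda\subseteq G$ be discrete and $g\in\mathcal B^2_\pi$, and suppose that $(\pi(\lambda)g)_{\lambda\in\Lambda}$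 is a frame for $\mathcal H_\pi$. If there exists a subset $\Gamma\subseteq\Lambda$ with $D^-(\Gamma)>0$ such that $(\pi(\lambda)g)_{\lambda\in\Lambda\setminus\Gamma}$ is a frame for $\mathcal H_\pi$, then $D^+(\Lambda)>d_\pi$. -/

import Mathlib

open MeasureTheory Filter
open scoped Pointwise ENNReal Topology ComplexConjugate

noncomputable section

namespace CoherentFrame

/-! ### Strong Folner sequences and Beurling densities -/

section Density

variable {G : Type*} [Group G] [TopologicalSpace G] [MeasurableSpace G]

/-- A (right) Folner sequence: compact sets of positive measure with
`μ (Kₙ C ∆ Kₙ) / μ Kₙ → 0` for every nonempty compact `C`.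
(For `C = ∅` the quotient is constantly `1`, so the empty set has to be left out.) -/
structure IsFolner (μ : Measure G) (K : ℕ → Set G) : Prop where
  isCompact : ∀ n, IsCompact (K n)
  measure_ne_zero : ∀ n, μ (K n) ≠ 0
  tendsto : ∀ C : Set G, IsCompact C → C.Nonempty →
    Tendsto (fun n => μ (symmDiff (K n * C) (K n)) / μ (K n)) atTop (𝓝 0)

/-- A (right) strong Folner sequence: a Folner sequence for which moreover
`μ (Kₙ C ∩ Kₙᶜ C) / μ Kₙ → 0` for every compact `C`. -/
structure IsStrongFolner (μ : Measure G) (K : ℕ → Set G) : Prop extends IsFolner μ K where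
  tendsto_boundary : ∀ C : Set G, IsCompact C →
    Tendsto (fun n => μ ((K n * C) ∩ ((K n)ᶜ * C)) / μ (K n)) atTop (𝓝 0)

/-- The lower Beurling density of `Λ` along `K`, with value in `[0, ∞]`:
the limit of `inf_x #(Λ ∩ x Kₙ) / μ Kₙ` as `n → ∞`, written as a limit inferior so that no
convergence is presupposed. -/
def lowerBeurlingDensity (μ : Measure G) (K : ℕ → Set G) (Λ : Set G) : ℝ≥0∞ :=
  liminf (fun n => ⨅ x : G, ((Λ ∩ x • K n).encard : ℝ≥0∞) / μ (K n)) atTop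

/-- The upper Beurling density of `Λ` along `K`, with value in `[0, ∞]`:
the limit of `sup_x #(Λ ∩ x Kₙ) / μ Kₙ` as `n → ∞`, written as a limit superior so that no
convergence is presupposed. -/
def upperBeurlingDensity (μ : Measure G) (K : ℕ → Set G) (Λ : Set G) : ℝ≥0∞ :=
  limsup (fun n => ⨆ x : G, ((Λ ∩ x • K n).encard : ℝ≥0∞) / μ (K n)) atTop

/-- The left local maximal function `M^L F (x) = ess sup_{z ∈ Q} |F (x z)|`. -/
def leftLocalMax (μ : Measure G) (Q : Set G) (F : G → ℂ) (x : G) : ℝ≥0∞ :=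
  essSup (fun z => ‖F (x * z)‖ₑ) (μ.restrict Q)

/-- Membership in the Wiener amalgam space `W^L (L^p)`: the function `F` is locally essentially
bounded and `M^L F` belongs to `L^p`. -/
def MemWienerAmalgam (μ : Measure G) (Q : Set G) (p : ℝ≥0∞) (F : G → ℂ) : Prop :=
  (∀ C : Set G, IsCompact C → MemLp F ∞ (μ.restrict C)) ∧ MemLp (leftLocalMax μ Q F) p μ

end Density

/-! ### Frames -/

/-- A family `v` in a Hilbert space is a frame if there are `A, B > 0` with
`A ‖f‖² ≤ ∑ᵢ |⟨f, vᵢ⟩|² ≤ B ‖f‖²` for all `f`. -/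
def IsFrame {H : Type*} [NormedAddCommGroup H] [InnerProductSpace ℂ H] {ι : Type*}
    (v : ι → H) : Prop :=
  ∃ A B : ℝ, 0 < A ∧ 0 < B ∧ ∀ f : H,
    Summable (fun i => ‖inner ℂ (v i) f‖ ^ 2) ∧
    A * ‖f‖ ^ 2 ≤ ∑' i, ‖inner ℂ (v i) f‖ ^ 2 ∧
    ∑' i, ‖inner ℂ (v i) f‖ ^ 2 ≤ B * ‖f‖ ^ 2

/-! ### Projective unitary representations -/

/-- A projective unitary representation of `G` on `H`: a strongly measurable family of unitary
operators with `π (x y) = σ (x, y) π (x) π (y)` for a function `σ` with values in the circle. -/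
structure ProjectiveRep (G H : Type*) [Group G] [MeasurableSpace G]
    [NormedAddCommGroup H] [InnerProductSpace ℂ H] where
  /-- The unitary operators. -/
  op : G → H ≃ₗᵢ[ℂ] H
  /-- The multiplier. -/
  cocycle : G → G → Circle
  op_mul : ∀ (x y : G) (f : H), op (x * y) f = (cocycle x y : ℂ) • op x (op y f)
  stronglyMeasurable : ∀ f : H, StronglyMeasurable (fun x => op x f)

namespace ProjectiveRep

variable {G H : Type*} [Group G] [TopologicalSpace G] [MeasurableSpace G]
  [NormedAddCommGroup H] [InnerProductSpace ℂ H]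

/-- The coefficient transform `V_g f (x) = ⟨f, π (x) g⟩`, where `⟨·, ·⟩` is linear in the first
variable (in Mathlib the inner product is linear in the second one). -/
def coeff (π : ProjectiveRep G H) (g f : H) (x : G) : ℂ := inner ℂ (π.op x g) f

/-- The only closed invariant subspaces are `{0}` and the whole space. -/
def IsIrreducible (π : ProjectiveRep G H) : Prop :=
  ∀ M : Submodule ℂ H, IsClosed (M : Set H) → (∀ (x : G), ∀ f ∈ M, π.op x f ∈ M) →
    M = ⊥ ∨ M = ⊤

/-- A discrete series (square-integrable) representation: irreducible, and `V_g g ∈ L²` for some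
nonzero `g`. -/
def IsDiscreteSeries (π : ProjectiveRep G H) (μ : Measure G) : Prop :=
  π.IsIrreducible ∧ ∃ g : H, g ≠ 0 ∧ MemLp (π.coeff g g) 2 μ

/-- The positive number `d` satisfies the orthogonality relations
`∫ ⟨f₁, π(x) g₁⟩ ⟨π(x) g₂, f₂⟩ dμ(x) = d⁻¹ ⟨f₁, f₂⟩ conj ⟨g₁, g₂⟩`. -/
def IsFormalDegree (π : ProjectiveRep G H) (μ : Measure G) (d : ℝ) : Prop :=
  0 < d ∧ ∀ f₁ f₂ g₁ g₂ : H,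
    Integrable (fun x => inner ℂ (π.op x g₁) f₁ * inner ℂ f₂ (π.op x g₂)) μ ∧
    ∫ x, inner ℂ (π.op x g₁) f₁ * inner ℂ f₂ (π.op x g₂) ∂μ =
      (d : ℂ)⁻¹ * inner ℂ f₂ f₁ * conj (inner ℂ g₂ g₁)

open Classical in
/-- The formal degree `d_π`: the positive number for which the orthogonality relations hold.
For a discrete series representation of a unimodular group it exists and is unique; the value `0`
is a default for other representations. -/
def formalDegree (π : ProjectiveRep G H) (μ : Measure G) : ℝ :=
  if h : ∃ d : ℝ, π.IsFormalDegree μ d then h.choose else 0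

/-- The space `B²_π` of vectors `g` with `V_g g ∈ W^L (L²)`. -/
def B2 (π : ProjectiveRep G H) (μ : Measure G) (Q : Set G) : Set H :=
  {g | MemWienerAmalgam μ Q 2 (π.coeff g g)}

/-- The coherent system `π (Λ) g = (π (λ) g)_{λ ∈ Λ}`. -/
def coherentSystem (π : ProjectiveRep G H) (Λ : Set G) (g : H) : Λ → H :=
  fun l => π.op (l : G) g

end ProjectiveRep

end CoherentFrame

end

/-! Write `r = ‖g‖²`, let `S` be the frame operator of `(π(l) g)` with `l ∈ Λ`, let `h_l = S⁻¹ π(l)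
g` be the canonical dual frame, and let `a_l = ⟨h_l, π(l) g⟩`. Two facts about the numbers `a_l` are
played against each other.

Upper bound: `a_l = ∑_j |⟨π(j) g, h_l⟩|²`, and the term `j = l` is `a_l²`, so `0 ≤ a_l ≤ 1`. If `l ∈
Γ` and the system over `Λ \ Γ` has lower frame bound `A`, the other terms contribute at least `A
‖h_l‖² ≥ A a_l² / r`, hence `a_l ≤ 1 - ε` with `ε = A / (A + r)`, uniformly on `Γ`
(`IsFrame.exists_dual_lt_one`). So the sum of `a_l` over `Λ ∩ Kₙ` is at most `#(Λ ∩ Kₙ) - ε #(Γ ∩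
Kₙ)`.

Lower bound: apply the reproducing formula to `π(x) g` and integrate over `x ∈ Kₙ`. The left side is
`r μ(Kₙ)`. For `l` well inside `Kₙ` the integral over `Kₙ` of the `l`-th term is nearly its integral
over `G`, which is `d⁻¹ r a_l` by the orthogonality relations; for `l` far outside it is negligible;
and the indices near the boundary are few by the strong Folner condition. Thus the sum of `a_l` over
`Λ ∩ Kₙ` is at least about `d μ(Kₙ)` (`IsFormalDegree.exists_mul_measure_le`). The assumption `g ∈
B²_π` makes the neglected tails uniformly small, through `exists_isCompact_tsum_compl_le`.

Together, `#(Λ ∩ Kₙ)` exceeds `d μ(Kₙ)` by about `ε #(Γ ∩ Kₙ)`, a positive proportion of `μ(Kₙ)`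
because `Γ` has positive lower density. The existence of a formal degree is itself proved, from
Schur's lemma applied to the graph of `f ↦ V_g f`. -/

namespace CoherentFrame

/-! ### Canonical dual frames and the gain from removable vectors -/

section Frames

variable {H : Type*} [NormedAddCommGroup H] [InnerProductSpace ℂ H] {ι : Type*}

/-- The analysis operator of a Bessel family, with values in `ℓ²`. -/
theorem exists_analysisOperator {v : ι → H} {B : ℝ} (hB : 0 < B)
    (hv : ∀ f : H, Summable (fun i => ‖inner ℂ (v i) f‖ ^ 2) ∧
      ∑' i, ‖inner ℂ (v i) f‖ ^ 2 ≤ B * ‖f‖ ^ 2) :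
    ∃ T : H →L[ℂ] lp (fun _ : ι => ℂ) 2, ∀ f i, T f i = inner ℂ (v i) f := by
  have hmem : ∀ f : H, Memℓp (fun i => (inner ℂ (v i) f : ℂ)) 2 := fun f => by
    refine memℓp_gen ?_
    simpa using (hv f).1
  let T₀ : H →ₗ[ℂ] lp (fun _ : ι => ℂ) 2 :=
    { toFun := fun f => ⟨fun i => (inner ℂ (v i) f : ℂ), hmem f⟩
      map_add' := fun f f' => by
        ext i
        exact inner_add_right _ _ _
      map_smul' := fun c f => by
        ext i
        exact inner_smul_right _ _ _ }
  refine ⟨T₀.mkContinuous (Real.sqrt B) fun f => ?_, fun f i => rfl⟩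
  have h2 : ‖T₀ f‖ ^ 2 = ∑' i, ‖inner ℂ (v i) f‖ ^ 2 := by
    have := lp.norm_rpow_eq_tsum (p := 2) (by norm_num) (T₀ f)
    simpa [T₀] using this
  refine le_of_sq_le_sq ?_ (by positivity)
  rw [h2, mul_pow, Real.sq_sqrt hB.le]
  exact (hv f).2

/-- The canonical dual frame. -/
theorem IsFrame.exists_dual [CompleteSpace H] {v : ι → H} (hv : IsFrame v) :
    ∃ (h : ι → H) (C : ℝ), 0 < C ∧
      (∀ f, HasSum (fun i => inner ℂ f (v i) * inner ℂ (h i) f) ((‖f‖ : ℂ) ^ 2)) ∧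
      (∀ f, Summable (fun i => ‖inner ℂ (h i) f‖ ^ 2) ∧
        ∑' i, ‖inner ℂ (h i) f‖ ^ 2 ≤ C * ‖f‖ ^ 2) ∧
      (∀ i, inner ℂ (h i) (v i) = ((∑' j, ‖inner ℂ (v j) (h i)‖ ^ 2 : ℝ) : ℂ)) ∧
      ∀ i, ‖h i‖ ≤ C * ‖v i‖ := by
  obtain ⟨A, B, hA, hB, hAB⟩ := hv
  obtain ⟨T, hT⟩ := exists_analysisOperator hB fun f => ⟨(hAB f).1, (hAB f).2.2⟩
  have hTn : ∀ f, ‖T f‖ ^ 2 = ∑' i, ‖inner ℂ (v i) f‖ ^ 2 := fun f => by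
    have := lp.norm_rpow_eq_tsum (p := 2) (by norm_num) (T f)
    simpa [hT] using this
  let S : H →L[ℂ] H := (ContinuousLinearMap.adjoint T) ∘L T
  have hS : ∀ f f', inner ℂ (S f) f' = inner ℂ (T f) (T f') := fun f f' => by
    simp [S, ContinuousLinearMap.adjoint_inner_left]
  have hS' : ∀ f f', inner ℂ f (S f') = inner ℂ (T f) (T f') := fun f f' => by
    simp [S, ContinuousLinearMap.adjoint_inner_right]
  have hself : ∀ f, (inner ℂ (T f) (T f) : ℂ) = ((‖T f‖ ^ 2 : ℝ) : ℂ) := fun f => by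
    rw [inner_self_eq_norm_sq_to_K]; norm_cast
  have hlow : ∀ f, A * ‖f‖ ^ 2 ≤ ‖T f‖ ^ 2 := fun f => by rw [hTn]; exact (hAB f).2.1
  -- The lower frame bound makes the frame operator coercive; its inverse `R` produces the dual
  -- vectors `R (v i)`.
  have hunit : IsUnit S := by
    refine ContinuousLinearMap.isUnit_of_forall_le_norm_inner_map S (c := ⟨A, hA.le⟩) hA ?_
    intro f
    rw [hS, hself, Complex.norm_real, Real.norm_of_nonneg (by positivity), mul_comm]
    exact hlow f
  obtain ⟨u, hu⟩ := hunit
  let R : H →L[ℂ] H := (u⁻¹ : (H →L[ℂ] H)ˣ)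
  have hSR : ∀ f, S (R f) = f := fun f => by
    rw [← hu]; exact congrArg (fun L : H →L[ℂ] H => L f) u.mul_inv
  have hRS : ∀ f f', inner ℂ (R f) f' = inner ℂ f (R f') := fun f f' => by
    conv_lhs => rw [← hSR f']
    conv_rhs => rw [← hSR f]
    rw [hS, hS']
  have hRn : ∀ f, A * ‖R f‖ ≤ ‖f‖ := fun f => by
    rcases (norm_nonneg (R f)).eq_or_lt with h0 | h0
    · rw [← h0]; simp
    refine le_of_mul_le_mul_right ?_ h0
    have h1 := hlow (R f)
    have h2 : (inner ℂ f (R f) : ℂ) = ((‖T (R f)‖ ^ 2 : ℝ) : ℂ) := by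
      rw [← hself, ← hS, hSR]
    have h3 := norm_inner_le_norm (𝕜 := ℂ) f (R f)
    rw [h2, Complex.norm_real, Real.norm_of_nonneg (by positivity)] at h3
    nlinarith
  have hRn' : ∀ f, ‖R f‖ ≤ A⁻¹ * ‖f‖ := fun f => by
    rw [inv_mul_eq_div, le_div_iff₀ hA, mul_comm]; exact hRn f
  refine ⟨fun i => R (v i), A⁻¹, inv_pos.2 hA, fun f => ?_, fun f => ?_, fun i => ?_,
    fun i => hRn' _⟩
  · have h1 := lp.hasSum_inner (𝕜 := ℂ) (T f) (T (R f))
    have h2 : inner ℂ (T f) (T (R f)) = (‖f‖ : ℂ) ^ 2 := by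
      rw [← hS', hSR, inner_self_eq_norm_sq_to_K]; rfl
    rw [h2] at h1
    refine h1.congr_fun fun i => ?_
    simp [hT, hRS, mul_comm]
  · have h1 : ∀ i, (inner ℂ (R (v i)) f : ℂ) = inner ℂ (v i) (R f) := fun i => hRS _ _
    simp only [h1]
    refine ⟨(hAB _).1, ?_⟩
    rw [← hTn]
    have h2 : (inner ℂ f (R f) : ℂ) = ((‖T (R f)‖ ^ 2 : ℝ) : ℂ) := by
      rw [← hself, ← hS, hSR]
    have h3 := norm_inner_le_norm (𝕜 := ℂ) f (R f)
    rw [h2, Complex.norm_real, Real.norm_of_nonneg (by positivity)] at h3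
    nlinarith [hRn' f, norm_nonneg f]
  · rw [← hTn, ← hself, ← hS', hSR]

/-- Vectors whose removal leaves a frame have uniformly small pairing with their canonical dual. -/
theorem IsFrame.exists_dual_lt_one [CompleteSpace H] {v : ι → H} {s : Set ι} {r : ℝ}
    (hv : IsFrame v) (hs : IsFrame (fun i : (sᶜ : Set ι) => v i)) (hr : ∀ i, ‖v i‖ ^ 2 = r)
    (hr0 : 0 < r) :
    ∃ (h : ι → H) (a : ι → ℝ) (C ε : ℝ), 0 < C ∧ 0 < ε ∧
      (∀ f, HasSum (fun i => inner ℂ f (v i) * inner ℂ (h i) f) ((‖f‖ : ℂ) ^ 2)) ∧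
      (∀ f, Summable (fun i => ‖inner ℂ (h i) f‖ ^ 2) ∧
        ∑' i, ‖inner ℂ (h i) f‖ ^ 2 ≤ C * ‖f‖ ^ 2) ∧
      (∀ i, inner ℂ (h i) (v i) = (a i : ℂ)) ∧
      (∀ i, ‖h i‖ ≤ C) ∧ (∀ i, 0 ≤ a i) ∧ (∀ i, a i ≤ 1) ∧ ∀ i ∈ s, a i ≤ 1 - ε := by
  obtain ⟨h, C, hC, h1, h2, h3, h4⟩ := hv.exists_dual
  obtain ⟨A, B, hA, hB, hAB⟩ := hs
  obtain ⟨A₁, B₁, hA₁, hB₁, hAB₁⟩ := hv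
  have hvn : ∀ i, ‖v i‖ = Real.sqrt r := fun i => by
    rw [← hr i, Real.sqrt_sq (norm_nonneg _)]
  let a : ι → ℝ := fun i => ∑' j, ‖inner ℂ (v j) (h i)‖ ^ 2
  have ha0 : ∀ i, 0 ≤ a i := fun i => tsum_nonneg fun j => by positivity
  have hai : ∀ i, ‖inner ℂ (v i) (h i)‖ = a i := fun i => by
    rw [norm_inner_symm, h3, Complex.norm_real, Real.norm_of_nonneg (ha0 i)]
  have ha1 : ∀ i, a i ^ 2 ≤ a i := fun i => by
    have := (hAB₁ (h i)).1.le_tsum i fun j _ => by positivity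
    rwa [hai] at this
  have hε : 0 < A / (A + r) := by positivity
  refine ⟨h, a, C + C * Real.sqrt r, A / (A + r), by positivity, hε, h1, fun f => ⟨(h2 f).1, ?_⟩,
    h3, fun i => ?_, ha0, fun i => by nlinarith [ha1 i, ha0 i], fun i hi => ?_⟩
  · refine (h2 f).2.trans ?_
    have : 0 ≤ C * Real.sqrt r * ‖f‖ ^ 2 := by positivity
    linarith
  · refine (h4 i).trans ?_
    rw [hvn]
    linarith
  -- Split the sum defining `a i` over `s` and its complement: the first part contains the term `a i
  -- ^ 2`, the second is bounded below by the frame that remains.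
  · have hle : a i ^ 2 + A * ‖h i‖ ^ 2 ≤ a i := by
      have hsum := (hAB₁ (h i)).1
      have h5 := hsum.tsum_subtype_add_tsum_subtype_compl s
      have h6 : ‖inner ℂ (v i) (h i)‖ ^ 2 ≤ ∑' j : s, ‖inner ℂ (v j) (h i)‖ ^ 2 :=
        (hsum.subtype s).le_tsum (⟨i, hi⟩ : s) fun j _ => sq_nonneg _
      have h7 := (hAB (h i)).2.1
      rw [hai] at h6
      have : a i = (∑' j : s, ‖inner ℂ (v j) (h i)‖ ^ 2) +
        ∑' j : (sᶜ : Set ι), ‖inner ℂ (v j) (h i)‖ ^ 2 := h5.symm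
      linarith
    have h8 : a i ^ 2 ≤ r * ‖h i‖ ^ 2 := by
      have := norm_inner_le_norm (𝕜 := ℂ) (v i) (h i)
      rw [hai] at this
      rw [← hr i, ← mul_pow]
      exact pow_le_pow_left₀ (ha0 i) this 2
    have h9 : (A + r) * a i ^ 2 ≤ r * a i := by nlinarith
    have h10 : 1 - A / (A + r) = r / (A + r) := by field_simp; ring
    rw [h10, le_div_iff₀ (by positivity)]
    rcases (ha0 i).eq_or_lt with h0 | h0
    · rw [← h0]; simp; exact hr0.le
    · refine le_of_mul_le_mul_right ?_ h0
      nlinarith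

end Frames

/-! ### Haar measure, relative separation and point counts -/

theorem tsum_indicator_one_eq_encard {G : Type*} (Λ S : Set G) :
    ∑' l : Λ, S.indicator (1 : G → ℝ≥0∞) l = ((Λ ∩ S).encard : ℝ≥0∞) := by
  rw [tsum_subtype Λ (S.indicator (1 : G → ℝ≥0∞)), Set.indicator_indicator,
    ← tsum_subtype (Λ ∩ S) (1 : G → ℝ≥0∞)]
  exact ENNReal.tsum_set_one _

section Group

variable {G : Type*} [Group G] [TopologicalSpace G] [IsTopologicalGroup G] [T2Space G]
  [LocallyCompactSpace G] [SecondCountableTopology G] [MeasurableSpace G] [BorelSpace G]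

/-- A Haar measure on a unimodular group is invariant under inversion. -/
theorem isInvInvariant_of_isMulRightInvariant (μ : Measure G) [μ.IsHaarMeasure]
    [μ.IsMulRightInvariant] : μ.IsInvInvariant := by
  constructor
  let c : ℝ≥0∞ := Measure.haarScalarFactor μ.inv μ
  have hc : μ.inv = c • μ := Measure.isMulLeftInvariant_eq_smul_of_regular μ.inv μ
  have h1 : Measure.map Inv.inv (Measure.map Inv.inv μ) = c ^ 2 • μ := by
    rw [← Measure.inv_def μ, hc, Measure.map_smul, ← Measure.inv_def μ, hc, smul_smul, pow_two]
  have μeq : μ = c ^ 2 • μ := by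
    rw [Measure.map_map continuous_inv.measurable continuous_inv.measurable] at h1
    rwa [show ((fun a : G => a⁻¹) ∘ fun a => a⁻¹) = id from inv_involutive.comp_self,
      Measure.map_id] at h1
  have K : TopologicalSpace.PositiveCompacts G := Classical.arbitrary _
  have h2 : c ^ 2 * μ K = 1 ^ 2 * μ K := by
    conv_rhs => rw [μeq]
    simp
  have h3 : c ^ 2 = 1 ^ 2 :=
    (ENNReal.mul_left_inj (Measure.measure_pos_of_nonempty_interior _ K.interior_nonempty).ne'
          K.isCompact.measure_lt_top.ne).1 h2
  have h4 : c = 1 := (ENNReal.pow_right_strictMono two_ne_zero).injective h3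
  rw [hc, h4, one_smul]

variable {μ : Measure G} [μ.IsHaarMeasure] [μ.IsMulRightInvariant]

/-- This is where unimodularity enters: periodizations are integrated in `x` with `l` fixed, so both
inversion and right translation must preserve `μ`. -/
theorem lintegral_inv_mul_eq_self (F : G → ℝ≥0∞) (l : G) :
    ∫⁻ x, F (x⁻¹ * l) ∂μ = ∫⁻ x, F x ∂μ := by
  have := isInvInvariant_of_isMulRightInvariant μ
  rw [lintegral_inv_eq_self (fun x => F (x * l)) , lintegral_mul_right_eq_self]

/-- If the `Λ`-periodizations of some nonzero function are bounded, then `Λ` is relatively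
separated. -/
theorem exists_encard_le_measure_mul {Λ : Set G} (hΛ : Λ.Countable) {φ : G → ℝ≥0∞}
    (hφ : Measurable φ) {b N : ℝ≥0∞} (hb : b ≠ ∞) (hφb : ∀ x, φ x ≤ b) (hN : N ≠ ∞)
    (hφN : ∀ x, ∑' l : Λ, φ (x⁻¹ * l) ≤ N) (hφ0 : ¬ φ =ᵐ[μ] 0) :
    ∃ C : Set G, IsCompact C ∧ ∃ M : ℝ≥0∞, M ≠ ∞ ∧
      ∀ S : Set G, ((Λ ∩ S).encard : ℝ≥0∞) ≤ M * μ (S * C) := by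
  have hE : ∃ E : Set G, IsCompact E ∧ ∫⁻ x in E, φ x ∂μ ≠ 0 := by
    by_contra! hcon
    refine hφ0 ?_
    have h1 : ∀ n, ∀ᵐ x ∂(μ.restrict (compactCovering G n)), φ x = 0 := fun n =>
      (lintegral_eq_zero_iff hφ).1 (hcon _ (isCompact_compactCovering G n))
    have h2 := ae_restrict_iUnion_iff (μ := μ) (compactCovering G) (fun x => φ x = 0)
    rw [iUnion_compactCovering, Measure.restrict_univ] at h2
    exact h2.2 h1
  obtain ⟨E, hE, hE0⟩ := hE
  set w := ∫⁻ x in E, φ x ∂μ with hw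
  have hwtop : w ≠ ∞ := by
    refine ne_top_of_le_ne_top (ENNReal.mul_ne_top hb (hE.measure_lt_top (μ := μ)).ne)
      ((lintegral_mono hφb).trans ?_)
    simp
  have hEm := hE.measurableSet
  refine ⟨E⁻¹, hE.inv, N / w, ENNReal.div_ne_top hN hE0, fun S => ?_⟩
  -- `S` is arbitrary, so `S * E⁻¹` may fail to be measurable; a measurable hull has the same
  -- measure. For `l ∈ S` the function `x ↦ ψ (x⁻¹ * l)` lives on `l E⁻¹ ⊆ Y`, so its integral over
  -- `Y` is the full mass `w`.
  set Y := toMeasurable μ (S * E⁻¹)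
  have hY : MeasurableSet Y := measurableSet_toMeasurable _ _
  have : Countable Λ := hΛ
  let ψ : G → ℝ≥0∞ := E.indicator φ
  have hψ : Measurable ψ := hφ.indicator hEm
  have key : ((Λ ∩ S).encard : ℝ≥0∞) * w ≤ N * μ (S * E⁻¹) := by
    calc ((Λ ∩ S).encard : ℝ≥0∞) * w = ∑' l : Λ, S.indicator 1 (l : G) * w := by
          rw [ENNReal.tsum_mul_right, tsum_indicator_one_eq_encard]
      _ ≤ ∑' l : Λ, ∫⁻ x in Y, ψ (x⁻¹ * l) ∂μ := by
          refine ENNReal.tsum_le_tsum fun l => ?_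
          by_cases hl : (l : G) ∈ S
          · rw [Set.indicator_of_mem hl, Pi.one_apply, one_mul, hw, ← lintegral_indicator hEm,
              ← lintegral_inv_mul_eq_self _ (l : G), ← lintegral_indicator hY]
            refine lintegral_mono fun x => ?_
            by_cases hx : x⁻¹ * (l : G) ∈ E
            · have : x ∈ Y := subset_toMeasurable _ _
                ⟨l, hl, (x⁻¹ * l)⁻¹, by simpa using hx, by simp⟩
              rw [Set.indicator_of_mem this]
            · simp [Set.indicator_of_notMem hx]
          · simp [Set.indicator_of_notMem hl]
      _ = ∫⁻ x in Y, ∑' l : Λ, ψ (x⁻¹ * l) ∂μ := by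
          rw [lintegral_tsum]
          intro l
          exact (hψ.comp (measurable_inv.mul_const (l : G))).aemeasurable
      _ ≤ ∫⁻ _ in Y, N ∂μ := lintegral_mono fun x =>
          (ENNReal.tsum_le_tsum fun l => Set.indicator_le_self _ _ _).trans (hφN x)
      _ = N * μ (S * E⁻¹) := by simp [Y]
  rw [div_eq_mul_inv, mul_right_comm, ← div_eq_mul_inv]
  exact (ENNReal.le_div_iff_mul_le (Or.inl hE0) (Or.inl hwtop)).2 key

/-- Averaging a lower bound for the number of points in the translates of a fixed set. -/
theorem mul_measure_le_encard {Γ L Y : Set G} (hΓ : Γ.Countable) (hL : IsCompact L)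
    (hL0 : μ L ≠ 0) (hY : IsCompact Y) {c : ℝ≥0∞}
    (hc : ∀ x : G, c * μ L ≤ ((Γ ∩ x • L).encard : ℝ≥0∞)) :
    c * μ Y ≤ ((Γ ∩ (Y * L)).encard : ℝ≥0∞) := by
  have : Countable Γ := hΓ
  have hLm := hL.measurableSet
  have key : c * μ Y * μ L ≤ ((Γ ∩ (Y * L)).encard : ℝ≥0∞) * μ L := by
    calc c * μ Y * μ L = ∫⁻ _ in Y, c * μ L ∂μ := by simp; ring
      _ ≤ ∫⁻ x in Y, ∑' l : Γ, L.indicator 1 (x⁻¹ * l) ∂μ := by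
          refine lintegral_mono fun x => (hc x).trans ?_
          rw [← tsum_indicator_one_eq_encard]
          refine ENNReal.tsum_le_tsum fun l => le_of_eq ?_
          have : (l : G) ∈ x • L ↔ x⁻¹ * (l : G) ∈ L := Set.mem_smul_set_iff_inv_smul_mem
          by_cases h : (l : G) ∈ x • L
          · rw [Set.indicator_of_mem h, Set.indicator_of_mem (this.1 h)]; rfl
          · rw [Set.indicator_of_notMem h, Set.indicator_of_notMem (mt this.2 h)]
      _ = ∑' l : Γ, ∫⁻ x in Y, L.indicator 1 (x⁻¹ * l) ∂μ := by
          rw [lintegral_tsum]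
          intro l
          exact ((measurable_one.indicator hLm).comp
            (measurable_inv.mul_const (l : G))).aemeasurable
      _ ≤ ∑' l : Γ, (Y * L).indicator 1 (l : G) * μ L := by
          refine ENNReal.tsum_le_tsum fun l => ?_
          by_cases hl : (l : G) ∈ Y * L
          · rw [Set.indicator_of_mem hl, Pi.one_apply, one_mul]
            refine (setLIntegral_le_lintegral _ _).trans (le_of_eq ?_)
            rw [lintegral_inv_mul_eq_self, lintegral_indicator_one hLm]
          · rw [Set.indicator_of_notMem hl, zero_mul, nonpos_iff_eq_zero]
            rw [← lintegral_indicator hY.measurableSet]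
            refine (lintegral_congr fun x => ?_).trans lintegral_zero
            by_cases hx : x ∈ Y
            · rw [Set.indicator_of_mem hx, Set.indicator_of_notMem]
              exact fun hx' => hl ⟨x, hx, _, hx', by simp⟩
            · rw [Set.indicator_of_notMem hx]
      _ = _ := by rw [ENNReal.tsum_mul_right, tsum_indicator_one_eq_encard]
  exact (ENNReal.mul_le_mul_iff_left hL0 hL.measure_lt_top.ne).1 key

/-- Positivity of the lower Beurling density does not depend on the strong Folner sequence. -/
theorem eventually_mul_measure_le_encard {Γ : Set G} (hΓ : Γ.Countable) {C : Set G}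
    (hC : IsCompact C) {M : ℝ≥0∞} (hM : M ≠ ∞)
    (hsep : ∀ S : Set G, ((Γ ∩ S).encard : ℝ≥0∞) ≤ M * μ (S * C))
    {K K' : ℕ → Set G} (hK : IsStrongFolner μ K) (hK' : IsStrongFolner μ K')
    (hpos : 0 < lowerBeurlingDensity μ K Γ) :
    ∃ c : ℝ≥0∞, c ≠ 0 ∧ ∀ᶠ n in atTop, c * μ (K' n) ≤ ((Γ ∩ K' n).encard : ℝ≥0∞) := by
  obtain ⟨c, hc0, hc⟩ := exists_between hpos
  have hctop : c ≠ ∞ := ne_top_of_lt hc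
  obtain ⟨m, hm⟩ := (eventually_lt_of_lt_liminf hc).exists
  set L := K m
  have hL : IsCompact L := hK.isCompact m
  have hL' : ∀ x : G, c * μ L ≤ ((Γ ∩ x • L).encard : ℝ≥0∞) := fun x =>
    ENNReal.mul_le_of_le_div (hm.le.trans (iInf_le _ x))
  -- With this `D`, a point `y l ∉ Y` multiplied by `z ∈ C` lies in `Y D` as `y (l z)` and in `Yᶜ D`
  -- as `(y l) (1 z)`. So the points counted in `Y L` but not in `Y` are controlled by the strong
  -- Folner boundary.
  set D := (insert 1 L) * C
  have hD : IsCompact D := (hL.insert 1).mul hC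
  have hlim := ENNReal.Tendsto.const_mul (a := M) (hK'.tendsto_boundary D hD) (Or.inr hM)
  rw [mul_zero] at hlim
  refine ⟨c / 2, (ENNReal.half_pos hc0.ne').ne', ?_⟩
  filter_upwards [hlim.eventually_lt_const (ENNReal.half_pos hc0.ne')] with n hn
  set Y := K' n
  have hY : IsCompact Y := hK'.isCompact n
  have hY0 : μ Y ≠ 0 := hK'.measure_ne_zero n
  have hYt : μ Y ≠ ∞ := hY.measure_lt_top.ne
  have h1 := mul_measure_le_encard hΓ hL (hK.measure_ne_zero m) hY hL'
  have h2 : Γ ∩ (Y * L) ⊆ (Γ ∩ Y) ∪ (Γ ∩ ((Y * L) \ Y)) := by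
    rintro x ⟨hx, hx'⟩
    by_cases hxY : x ∈ Y
    · exact Or.inl ⟨hx, hxY⟩
    · exact Or.inr ⟨hx, hx', hxY⟩
  have h3 : ((Γ ∩ (Y * L)).encard : ℝ≥0∞) ≤
      ((Γ ∩ Y).encard : ℝ≥0∞) + ((Γ ∩ ((Y * L) \ Y)).encard : ℝ≥0∞) := by
    rw [← ENat.toENNReal_add]
    exact ENat.toENNReal_le.2 ((Set.encard_le_encard h2).trans (Set.encard_union_le _ _))
  have h4 : ((Y * L) \ Y) * C ⊆ (Y * D) ∩ (Yᶜ * D) := by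
    rintro _ ⟨x, ⟨⟨y, hy, l, hl, rfl⟩, hx⟩, z, hz, rfl⟩
    refine ⟨⟨y, hy, l * z, ⟨l, Or.inr hl, z, hz, rfl⟩, ?_⟩,
      ⟨y * l, hx, z, ⟨1, Or.inl rfl, z, hz, by simp⟩, rfl⟩⟩
    simp [mul_assoc]
  have h5 : ((Γ ∩ ((Y * L) \ Y)).encard : ℝ≥0∞) ≤ c / 2 * μ Y := by
    refine (hsep _).trans ((mul_le_mul_right (measure_mono h4) M).trans ?_)
    rw [← mul_div_assoc] at hn
    exact (ENNReal.div_le_iff hY0 hYt).1 hn.le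
  have h6 : c / 2 * μ Y + c / 2 * μ Y ≤ ((Γ ∩ Y).encard : ℝ≥0∞) + c / 2 * μ Y := by
    rw [← add_mul, ENNReal.add_halves]
    exact h1.trans (h3.trans (add_le_add_right h5 _))
  exact (ENNReal.add_le_add_iff_right
    (ENNReal.mul_ne_top (ENNReal.div_ne_top hctop two_ne_zero) hYt)).1 h6

end Group

/-! ### Uniform tails of samples of amalgam functions -/

section Group

variable {G : Type*} [Group G] [TopologicalSpace G] [IsTopologicalGroup G] [T2Space G]
  [LocallyCompactSpace G] [SecondCountableTopology G] [MeasurableSpace G] [BorelSpace G]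
  {μ : Measure G}

/-- Continuity from above of the measure `f μ` along the complements of a compact exhaustion. -/
theorem exists_isCompact_setLIntegral_compl_le {f : G → ℝ≥0∞}
    (hfi : ∫⁻ x, f x ∂μ ≠ ∞) {δ : ℝ≥0∞} (hδ : δ ≠ 0) :
    ∃ C : Set G, IsCompact C ∧ ∫⁻ x in Cᶜ, f x ∂μ ≤ δ := by
  have hC : ∀ n, MeasurableSet (compactCovering G n) := fun n =>
    (isCompact_compactCovering G n).measurableSet
  have hlim := tendsto_measure_iInter_atTop (μ := μ.withDensity f)
    (s := fun n => (compactCovering G n)ᶜ)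
    (fun n => (hC n).compl.nullMeasurableSet)
    (fun m n hmn => Set.compl_subset_compl.2 (compactCovering_subset G hmn))
    ⟨0, by
      rw [withDensity_apply _ (hC 0).compl]
      exact ne_top_of_le_ne_top hfi (setLIntegral_le_lintegral _ _)⟩
  rw [← Set.compl_iUnion, iUnion_compactCovering, Set.compl_univ, measure_empty] at hlim
  obtain ⟨n, hn⟩ := (hlim.eventually_lt_const (pos_iff_ne_zero.2 hδ)).exists
  refine ⟨_, isCompact_compactCovering G n, ?_⟩
  rw [Function.comp_apply, withDensity_apply _ (hC n).compl] at hn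
  exact hn.le

/-- A function is dominated almost everywhere by local averages of its local maximal function. -/
theorem ae_measure_mul_le_lintegral [μ.IsHaarMeasure] {Q : Set G}
    (hQ : IsCompact Q) (hQ_symm : Q⁻¹ = Q) {F : G → ℂ} (hF : Measurable F) {m : G → ℝ≥0∞} (hm : Measurable m)
    (hmF : leftLocalMax μ Q F =ᵐ[μ] m) :
    ∀ᵐ y ∂μ, μ Q * ‖F y‖ₑ ^ 2 ≤ ∫⁻ w, Q.indicator 1 (y⁻¹ * w) * m w ^ 2 ∂μ := by
  have hQm := hQ.measurableSet
  -- The essential supremum controls almost every `y` for fixed `w`; Fubini for null sets exchanges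
  -- the two quantifiers, after which one integrates over `w ∈ y Q`.
  have h1 : ∀ᵐ w ∂μ, ∀ᵐ y ∂μ, w⁻¹ * y ∈ Q → ‖F y‖ₑ ≤ m w := by
    filter_upwards [hmF] with w hw
    have h2 : ∀ᵐ z ∂(μ.restrict Q), ‖F (w * z)‖ₑ ≤ leftLocalMax μ Q F w :=
      ENNReal.ae_le_essSup fun z => ‖F (w * z)‖ₑ
    rw [ae_restrict_iff' hQm] at h2
    have h3 := (measurePreserving_mul_left μ w⁻¹).quasiMeasurePreserving.ae h2
    filter_upwards [h3] with y hy hyQ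
    rw [← hw]
    simpa using hy hyQ
  have hmeas : MeasurableSet {p : G × G | p.1⁻¹ * p.2 ∈ Q → ‖F p.2‖ₑ ≤ m p.1} := by
    have e1 : MeasurableSet {p : G × G | p.1⁻¹ * p.2 ∈ Q} :=
      (measurable_fst.inv.mul measurable_snd) hQm
    have e2 : MeasurableSet {p : G × G | ‖F p.2‖ₑ ≤ m p.1} :=
      measurableSet_le (hF.comp measurable_snd).enorm (hm.comp measurable_fst)
    exact e1.imp e2
  have h4 := (Measure.ae_ae_comm (μ := μ) (ν := μ)
    (p := fun w y => w⁻¹ * y ∈ Q → ‖F y‖ₑ ≤ m w) hmeas).1 h1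
  filter_upwards [h4] with y hy
  have h5 : μ Q = ∫⁻ w, Q.indicator 1 (y⁻¹ * w) ∂μ := by
    rw [lintegral_mul_left_eq_self, lintegral_indicator_one hQm]
  have h6 : Measurable fun w => Q.indicator (1 : G → ℝ≥0∞) (y⁻¹ * w) :=
    (measurable_one.indicator hQm).comp (measurable_const_mul y⁻¹)
  rw [h5, ← lintegral_mul_const _ h6]
  refine lintegral_mono_ae ?_
  filter_upwards [hy] with w hw
  by_cases hwQ : y⁻¹ * w ∈ Q
  · have : w⁻¹ * y ∈ Q := by
      rw [← hQ_symm, Set.mem_inv]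
      simpa using hwQ
    gcongr
    exact hw this
  · simp [Set.indicator_of_notMem hwQ]

/-- Samples over a relatively separated set of a function in `W^L (L²)` have uniformly small
tails. -/
theorem exists_isCompact_tsum_compl_le [μ.IsHaarMeasure] [μ.IsMulRightInvariant]
    {Q : Set G} (hQ : IsCompact Q) (hQ_symm : Q⁻¹ = Q)
    (hQ_nhds : Q ∈ 𝓝 (1 : G)) {F : G → ℂ} (hF : Measurable F)
    (hFQ : MemLp (leftLocalMax μ Q F) 2 μ) {Λ : Set G} (hΛ : Λ.Countable) {C₀ : Set G}
    (hC₀ : IsCompact C₀) {M : ℝ≥0∞} (hM : M ≠ ∞)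
    (hsep : ∀ S : Set G, ((Λ ∩ S).encard : ℝ≥0∞) ≤ M * μ (S * C₀)) {ε : ℝ≥0∞} (hε : ε ≠ 0) :
    ∃ C : Set G, IsCompact C ∧
      ∀ᵐ x ∂μ, ∑' l : Λ, Cᶜ.indicator (fun y => ‖F y‖ₑ ^ 2) (x⁻¹ * l) ≤ ε := by
  have hinv := isInvInvariant_of_isMulRightInvariant μ
  have : Countable Λ := hΛ
  have hQm := hQ.measurableSet
  have hQ0 : μ Q ≠ 0 := (Measure.measure_pos_of_mem_nhds μ hQ_nhds).ne'
  have hQt : μ Q ≠ ∞ := hQ.measure_lt_top.ne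
  obtain ⟨m, hm, hmF⟩ : ∃ m : G → ℝ≥0∞, Measurable m ∧ leftLocalMax μ Q F =ᵐ[μ] m :=
    ⟨hFQ.1.mk _, hFQ.1.stronglyMeasurable_mk.measurable, hFQ.1.ae_eq_mk⟩
  have hmi : ∫⁻ x, m x ^ 2 ∂μ ≠ ∞ := by
    have h1 := lintegral_rpow_enorm_lt_top_of_eLpNorm_lt_top two_ne_zero ENNReal.ofNat_ne_top hFQ.2
    have h2 : ∫⁻ x, m x ^ 2 ∂μ = ∫⁻ x, ‖leftLocalMax μ Q F x‖ₑ ^ (2 : ℝ≥0∞).toReal ∂μ := by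
      refine lintegral_congr_ae ?_
      filter_upwards [hmF] with x hx
      simp [hx]
    rw [h2]
    exact h1.ne
  set N := M * μ (Q * C₀) with hN
  have hNt : N ≠ ∞ := ENNReal.mul_ne_top hM (hQ.mul hC₀).measure_lt_top.ne
  -- `N` bounds the overlap of the sets `x⁻¹ l Q`, so the sampled tail costs at most `N / μ Q` times
  -- the integral of `m²` off `C'`. The denominator `N + 1` avoids dividing by zero.
  obtain ⟨C', hC', hC'i⟩ := exists_isCompact_setLIntegral_compl_le (μ := μ) hmi
    (δ := ε * μ Q / (N + 1))
    (ENNReal.div_ne_zero.2 ⟨mul_ne_zero hε hQ0, by finiteness⟩)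
  have hC'm := hC'.measurableSet
  refine ⟨C' * Q, hC'.mul hQ, ?_⟩
  have hae : ∀ᵐ x ∂μ, ∀ l : Λ, μ Q * ‖F (x⁻¹ * l)‖ₑ ^ 2 ≤
      ∫⁻ w, Q.indicator 1 ((x⁻¹ * l)⁻¹ * w) * m w ^ 2 ∂μ := by
    refine ae_all_iff.2 fun l => ?_
    exact ((measurePreserving_mul_right μ (l : G)).comp
      (Measure.measurePreserving_inv μ)).quasiMeasurePreserving.ae
        (ae_measure_mul_le_lintegral hQ hQ_symm hF hm hmF)
  filter_upwards [hae] with x hx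
  have hcount : ∀ w : G, ∑' l : Λ, Q.indicator (1 : G → ℝ≥0∞) ((x⁻¹ * l)⁻¹ * w) ≤ N := by
    intro w
    have h1 : N = M * μ (((x * w) • Q) * C₀) := by
      rw [hN, smul_mul_assoc, measure_smul]
    rw [h1]
    refine le_trans ?_ (hsep _)
    rw [← tsum_indicator_one_eq_encard]
    refine ENNReal.tsum_le_tsum fun l => ?_
    by_cases hl : (x⁻¹ * l)⁻¹ * w ∈ Q
    · have : (l : G) ∈ (x * w) • Q := by
        rw [Set.mem_smul_set_iff_inv_smul_mem, ← hQ_symm, Set.mem_inv]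
        simpa [mul_assoc] using hl
      rw [Set.indicator_of_mem hl, Set.indicator_of_mem this]
      rfl
    · rw [Set.indicator_of_notMem hl]
      exact zero_le
  have key : μ Q * ∑' l : Λ, (C' * Q)ᶜ.indicator (fun y => ‖F y‖ₑ ^ 2) (x⁻¹ * l) ≤ μ Q * ε := by
    calc μ Q * ∑' l : Λ, (C' * Q)ᶜ.indicator (fun y => ‖F y‖ₑ ^ 2) (x⁻¹ * l)
        = ∑' l : Λ, μ Q * (C' * Q)ᶜ.indicator (fun y => ‖F y‖ₑ ^ 2) (x⁻¹ * l) :=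
          ENNReal.tsum_mul_left.symm
      _ ≤ ∑' l : Λ, ∫⁻ w in C'ᶜ, Q.indicator 1 ((x⁻¹ * l)⁻¹ * w) * m w ^ 2 ∂μ := by
          refine ENNReal.tsum_le_tsum fun l => ?_
          by_cases hl : x⁻¹ * (l : G) ∈ (C' * Q)
          · rw [Set.indicator_of_notMem (Set.notMem_compl_iff.2 hl), mul_zero]
            exact zero_le
          · rw [Set.indicator_of_mem (show x⁻¹ * (l : G) ∈ (C' * Q)ᶜ from hl)]
            refine (hx l).trans ?_
            rw [← lintegral_indicator hC'm.compl]
            refine lintegral_mono fun w => ?_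
            by_cases hw : w ∈ C'
            -- For `y ∉ C' Q` the set `y Q` misses `C'`, by symmetry of `Q`; hence only `w ∉ C'`
            -- contributes.
            · have : (x⁻¹ * (l : G))⁻¹ * w ∉ Q := fun hwQ => hl
                ⟨w, hw, ((x⁻¹ * (l : G))⁻¹ * w)⁻¹, by rw [← hQ_symm]; simpa using hwQ, by simp⟩
              rw [Set.indicator_of_notMem this, zero_mul]
              exact zero_le
            · rw [Set.indicator_of_mem (show w ∈ C'ᶜ from hw)]
      _ = ∫⁻ w in C'ᶜ, ∑' l : Λ, Q.indicator 1 ((x⁻¹ * l)⁻¹ * w) * m w ^ 2 ∂μ := by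
          rw [lintegral_tsum]
          intro l
          exact (((measurable_one.indicator hQm).comp
            (measurable_const_mul _)).mul (hm.pow_const 2)).aemeasurable
      _ ≤ ∫⁻ w in C'ᶜ, N * m w ^ 2 ∂μ := by
          refine lintegral_mono fun w => ?_
          rw [ENNReal.tsum_mul_right]
          gcongr
          exact hcount w
      _ = N * ∫⁻ w in C'ᶜ, m w ^ 2 ∂μ := lintegral_const_mul _ (hm.pow_const 2)
      _ ≤ (N + 1) * (ε * μ Q / (N + 1)) := mul_le_mul' le_self_add hC'i
      _ = μ Q * ε := by
          rw [ENNReal.mul_div_cancel (by simp) (by finiteness), mul_comm]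
  exact (ENNReal.mul_le_mul_iff_right hQ0 hQt).1 key

end Group

/-! ### Coefficient functions and the trace estimate -/

namespace ProjectiveRep

section Basic

variable {G H : Type*} [Group G] [MeasurableSpace G]
  [NormedAddCommGroup H] [InnerProductSpace ℂ H] (π : ProjectiveRep G H)

/-- The multiplier has modulus one, so it disappears from absolute values, which become translates
of a single coefficient function. -/
theorem norm_inner_op_op (x y : G) (f f' : H) :
    ‖inner ℂ (π.op x f) (π.op y f')‖ = ‖π.coeff f' f (x⁻¹ * y)‖ := by
  have h1 := π.op_mul x (x⁻¹ * y) f'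
  rw [mul_inv_cancel_left] at h1
  rw [h1, inner_smul_right, LinearIsometryEquiv.inner_map_map, norm_mul, Circle.norm_coe, one_mul,
    norm_inner_symm, coeff]

theorem measurable_coeff (g f : H) : Measurable (π.coeff g f) :=
  ((π.stronglyMeasurable g).inner stronglyMeasurable_const).measurable

variable {π} {μ : Measure G} {d : ℝ}

theorem IsFormalDegree.integrable_norm_sq (hd : π.IsFormalDegree μ d) (g f : H) :
    Integrable (fun x => ‖inner ℂ (π.op x g) f‖ ^ 2) μ := by
  have h1 := ((hd.2 f f g g).1).re
  refine h1.congr (Eventually.of_forall fun x => ?_)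
  have h2 : inner ℂ (π.op x g) f * inner ℂ f (π.op x g) =
      ((‖inner ℂ (π.op x g) f‖ ^ 2 : ℝ) : ℂ) := by
    rw [← inner_conj_symm f, RCLike.mul_conj]; norm_cast
  simp only [h2]
  exact Complex.ofReal_re _

theorem IsFormalDegree.integral_norm_sq (hd : π.IsFormalDegree μ d) (g f : H) :
    ∫ x, ‖inner ℂ (π.op x g) f‖ ^ 2 ∂μ = d⁻¹ * ‖f‖ ^ 2 * ‖g‖ ^ 2 := by
  have h1 := (hd.2 f f g g).2
  have h2 : ∀ x, inner ℂ (π.op x g) f * inner ℂ f (π.op x g) =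
      ((‖inner ℂ (π.op x g) f‖ ^ 2 : ℝ) : ℂ) := fun x => by
    rw [← inner_conj_symm f, RCLike.mul_conj]; norm_cast
  simp only [h2] at h1
  rw [integral_complex_ofReal, inner_self_eq_norm_sq_to_K, inner_self_eq_norm_sq_to_K] at h1
  have h3 : ((∫ x, ‖inner ℂ (π.op x g) f‖ ^ 2 ∂μ : ℝ) : ℂ) =
      ((d⁻¹ * ‖f‖ ^ 2 * ‖g‖ ^ 2 : ℝ) : ℂ) := by
    rw [h1]; push_cast; simp
  exact_mod_cast h3

end Basic

section Estimate

variable {G H : Type*} [Group G] [TopologicalSpace G] [IsTopologicalGroup G] [T2Space G]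
  [LocallyCompactSpace G] [SecondCountableTopology G] [MeasurableSpace G] [BorelSpace G]
  [NormedAddCommGroup H] [InnerProductSpace ℂ H]
  {μ : Measure G} [μ.IsHaarMeasure] [μ.IsMulRightInvariant] {π : ProjectiveRep G H} {d : ℝ}

/-- An upper bound of the measure of `K` by the traces of the dual pairs with index in `K`. -/
theorem IsFormalDegree.exists_mul_measure_le (hd : π.IsFormalDegree μ d)
    {Q : Set G} (hQ : IsCompact Q) (hQ_symm : Q⁻¹ = Q) (hQ_nhds : Q ∈ 𝓝 (1 : G))
    {g : H} (hg : g ∈ π.B2 μ Q) {Λ : Set G} (hΛ : Λ.Countable) {C₀ : Set G}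
    (hC₀ : IsCompact C₀) {M : ℝ≥0∞} (hM : M ≠ ∞)
    (hsep : ∀ S : Set G, ((Λ ∩ S).encard : ℝ≥0∞) ≤ M * μ (S * C₀))
    {h : Λ → H} {a : Λ → ℝ} {c : ℝ} (hc : 0 < c)
    (hrec : ∀ f, HasSum (fun l : Λ => inner ℂ f (π.op l g) * inner ℂ (h l) f) ((‖f‖ : ℂ) ^ 2))
    (hbes : ∀ f, Summable (fun l => ‖inner ℂ (h l) f‖ ^ 2) ∧
      ∑' l, ‖inner ℂ (h l) f‖ ^ 2 ≤ c * ‖f‖ ^ 2)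
    (hha : ∀ l : Λ, inner ℂ (h l) (π.op l g) = (a l : ℂ)) (hhn : ∀ l, ‖h l‖ ≤ c)
    (ha0 : ∀ l, 0 ≤ a l) (ha1 : ∀ l, a l ≤ 1) {η : ℝ} (hη : 0 < η) :
    ∃ D : Set G, IsCompact D ∧ ∃ R : ℝ, 0 ≤ R ∧ ∀ K : Set G, IsCompact K → ∀ P : Finset Λ,
      (∀ l : Λ, l ∈ P ↔ (l : G) ∈ K) →
      (‖g‖ ^ 2 - η) * μ.real K ≤ d⁻¹ * ‖g‖ ^ 2 * ∑ l ∈ P, a l + η * P.card +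
        R * μ.real ((K * D) ∩ (Kᶜ * D)) := by
  have : Countable Λ := hΛ
  have hd0 : 0 < d := hd.1
  set r := ‖g‖ ^ 2 with hr
  have hr0 : 0 ≤ r := by positivity
  set V : G → ℂ := π.coeff g g with hV
  have hVm : Measurable V := π.measurable_coeff g g
  -- choice of the auxiliary parameter `t`
  set b : ℝ := 1 + c * r + d⁻¹ * c ^ 2 * r with hb
  have hb0 : 0 < b := by positivity
  set t : ℝ := η / b with ht
  have ht0 : 0 < t := by positivity
  have htb : t * b = η := by rw [ht]; field_simp
  have ht2 : ENNReal.ofReal (t ^ 2) ≠ 0 := by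
    rw [Ne, ENNReal.ofReal_eq_zero, not_le]; positivity
  obtain ⟨C₁, hC₁, hC₁t⟩ := exists_isCompact_tsum_compl_le (μ := μ) hQ hQ_symm hQ_nhds hVm hg.2
    hΛ hC₀ hM hsep ht2
  have hVi : Integrable (fun x => ‖V x‖ ^ 2) μ := hd.integrable_norm_sq g g
  have hVl : ∫⁻ x, ‖V x‖ₑ ^ 2 ∂μ ≠ ∞ := by
    have := hVi.2
    rw [hasFiniteIntegral_iff_enorm] at this
    simpa using this.ne
  obtain ⟨C₂, hC₂, hC₂t⟩ := exists_isCompact_setLIntegral_compl_le (μ := μ) hVl ht2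
  set C : Set G := insert 1 (C₁ ∪ C₂) with hCdef
  have hC : IsCompact C := (hC₁.union hC₂).insert 1
  have hCm : MeasurableSet C := hC.measurableSet
  have h1C : (1 : G) ∈ C := Set.mem_insert _ _
  set w : G → ℝ≥0∞ := Cᶜ.indicator (fun y => ‖V y‖ₑ ^ 2) with hw
  have hwt : ∀ y, w y ≠ ∞ := fun y =>
    ne_top_of_le_ne_top (by finiteness) (Set.indicator_le_self _ _ y)
  have hwm : Measurable w := (hVm.enorm.pow_const 2).indicator hCm.compl
  have htail : ∀ᵐ x ∂μ, ∑' l : Λ, w (x⁻¹ * l) ≤ ENNReal.ofReal (t ^ 2) := by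
    filter_upwards [hC₁t] with x hx
    refine le_trans (ENNReal.tsum_le_tsum fun l => ?_) hx
    exact Set.indicator_le_indicator_of_subset
      (Set.compl_subset_compl.2 fun y hy => Or.inr (Or.inl hy)) (fun _ => zero_le) _
  have hwi : ∫⁻ x, w x ∂μ ≤ ENNReal.ofReal (t ^ 2) := by
    rw [hw, lintegral_indicator hCm.compl]
    exact (lintegral_mono_set
      (Set.compl_subset_compl.2 fun y hy => Or.inr (Or.inr hy))).trans hC₂t
  have hwV : ∀ y, y ∉ C → (w y).toReal = ‖V y‖ ^ 2 := fun y hy => by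
    rw [hw, Set.indicator_of_mem (show y ∈ Cᶜ from hy)]
    simp
  -- the summands of the reproducing formula
  set F : Λ → G → ℂ := fun l x => inner ℂ (π.op x g) (π.op l g) * inner ℂ (h l) (π.op x g) with hF
  have hFi : ∀ l, Integrable (F l) μ := fun l => (hd.2 (π.op l g) (h l) g g).1
  have hFire : ∀ l, Integrable (fun x => (F l x).re) μ := fun l => (hFi l).re
  have hFint : ∀ l, ∫ x, (F l x).re ∂μ = d⁻¹ * r * a l := fun l => by
    have h1 := (hd.2 (π.op l g) (h l) g g).2
    have h2 : ∫ x, (F l x).re ∂μ = (∫ x, F l x ∂μ).re := integral_re (hFi l)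
    rw [h2, h1, hha, inner_self_eq_norm_sq_to_K]
    have h3 : (d : ℂ)⁻¹ * (a l : ℂ) * conj (((‖g‖ : ℝ) : ℂ) ^ 2) =
        ((d⁻¹ * r * a l : ℝ) : ℂ) := by
      rw [map_pow, Complex.conj_ofReal, hr]; push_cast; ring
    have h4 := congrArg Complex.re h3
    rwa [Complex.ofReal_re] at h4
  set u : Λ → G → ℝ := fun l x => ‖inner ℂ (π.op x g) (π.op l g)‖ ^ 2 with hu
  set v : Λ → G → ℝ := fun l x => ‖inner ℂ (h l) (π.op x g)‖ ^ 2 with hv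
  have huV : ∀ l x, u l x = ‖V (x⁻¹ * l)‖ ^ 2 := fun l x => by
    simp only [hu, norm_inner_op_op, hV]
  have hui : ∀ l, Integrable (u l) μ := fun l => hd.integrable_norm_sq g (π.op l g)
  have huint : ∀ l, ∫ x, u l x ∂μ = d⁻¹ * r * r := fun l => by
    simp only [hu]
    rw [hd.integral_norm_sq, LinearIsometryEquiv.norm_map]
  have hvsymm : ∀ l x, v l x = ‖inner ℂ (π.op x g) (h l)‖ ^ 2 := fun l x => by
    simp only [hv, norm_inner_symm]
  have hvi : ∀ l, Integrable (v l) μ := fun l =>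
    (hd.integrable_norm_sq g (h l)).congr (Eventually.of_forall fun x => (hvsymm l x).symm)
  have hvint : ∀ l, ∫ x, v l x ∂μ ≤ d⁻¹ * c ^ 2 * r := fun l => by
    simp only [hvsymm]
    rw [hd.integral_norm_sq]
    have := hhn l
    gcongr
  -- Weighted AM-GM: `u` will be summed or integrated only over tails of size `t ^ 2`, so the
  -- weights `t⁻¹` and `t` make both contributions of order `t`. The constant `b` collects the
  -- coefficients from the two uses below, the sum over `l` and the integral over `x`.
  have hFuv : ∀ l x, ‖F l x‖ ≤ (t⁻¹ * u l x + t * v l x) / 2 := fun l x => by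
    simp only [hF, norm_mul, hu, hv]
    generalize ‖inner ℂ (π.op x g) (π.op l g)‖ = p
    generalize ‖inner ℂ (h l) (π.op x g)‖ = q
    have h1 : t⁻¹ * p ^ 2 + t * q ^ 2 - 2 * (p * q) = t⁻¹ * (p - t * q) ^ 2 := by
      field_simp; ring
    have h2 : 0 ≤ t⁻¹ * (p - t * q) ^ 2 := by positivity
    linarith
  have hFuv1 : ∀ l x, ‖F l x‖ ≤ (u l x + v l x) / 2 := fun l x => by
    simp only [hF, norm_mul, hu, hv]
    nlinarith [sq_nonneg (‖inner ℂ (π.op x g) (π.op l g)‖ - ‖inner ℂ (h l) (π.op x g)‖)]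
  -- A crude bound for the integral over `K` of any single term; it is charged to each index near
  -- the boundary.
  set β : ℝ := d⁻¹ * r + (d⁻¹ * r * r + d⁻¹ * c ^ 2 * r) / 2 with hβ
  have hβ0 : 0 ≤ β := by positivity
  refine ⟨C * C₀, hC.mul hC₀, β * M.toReal, by positivity, fun K hK P hP => ?_⟩
  have hKm := hK.measurableSet
  have hKt : μ K ≠ ∞ := hK.measure_lt_top.ne
  -- the finitely many indices in `K * C`
  have hfin : {l : Λ | (l : G) ∈ K * C}.Finite := by
    have h1 : (Λ ∩ (K * C)).encard ≠ ⊤ := fun htop => by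
      have h2 := hsep (K * C)
      rw [htop] at h2
      exact (ENNReal.mul_ne_top hM ((hK.mul hC).mul hC₀).measure_lt_top.ne) (top_le_iff.1 h2)
    have h3 : (Λ ∩ (K * C)).Finite := Set.encard_ne_top_iff.1 h1
    refine Set.Finite.of_finite_image (f := ((↑) : Λ → G)) (h3.subset ?_)
      Subtype.val_injective.injOn
    rintro _ ⟨l, hl, rfl⟩
    exact ⟨l.2, hl⟩
  set s : Finset Λ := hfin.toFinset with hs
  have hsmem : ∀ l : Λ, l ∈ s ↔ (l : G) ∈ K * C := fun l => by simp [hs]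
  -- Having `1 ∈ C` gives `K ⊆ K C`; likewise it will place every index outside `K` in `Kᶜ C`.
  have hPs : P ⊆ s := fun l hl => (hsmem l).2 ⟨l, (hP l).1 hl, 1, h1C, mul_one _⟩
  -- pointwise estimate on `K`
  have hpt : ∀ᵐ x ∂μ, x ∈ K → r - η ≤ ∑ l ∈ s, (F l x).re := by
    filter_upwards [htail] with x hx hxK
    have e1 : HasSum (fun l => F l x) ((r : ℝ) : ℂ) := by
      have := hrec (π.op x g)
      rw [LinearIsometryEquiv.norm_map] at this
      rw [hr]; push_cast; exact this
    have e2 : HasSum (fun l : {l // l ∉ s} => F l x) ((r : ℂ) - ∑ l ∈ s, F l x) := by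
      refine (s.hasSum_compl_iff (f := fun l => F l x)).2 ?_
      simpa using e1
    have e3 : Summable (fun l : Λ => (w (x⁻¹ * l)).toReal) :=
      ENNReal.summable_toReal (ne_top_of_le_ne_top (by finiteness) hx)
    have e4 : ∑' l : Λ, (w (x⁻¹ * l)).toReal ≤ t ^ 2 := by
      rw [← ENNReal.tsum_toReal_eq fun l => hwt _]
      exact ENNReal.toReal_le_of_le_ofReal (by positivity) hx
    have e5 : Summable (fun l : Λ => (t⁻¹ * (w (x⁻¹ * l)).toReal + t * v l x) / 2) :=
      ((e3.mul_left _).add ((hbes (π.op x g)).1.mul_left _)).div_const _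
    have e6 : ∑' l : Λ, (t⁻¹ * (w (x⁻¹ * l)).toReal + t * v l x) / 2 ≤ η := by
      rw [tsum_div_const, (e3.mul_left _).tsum_add ((hbes (π.op x g)).1.mul_left _), tsum_mul_left,
        tsum_mul_left]
      have e7 := (hbes (π.op x g)).2
      rw [LinearIsometryEquiv.norm_map] at e7
      have e8 : t⁻¹ * ∑' l : Λ, (w (x⁻¹ * l)).toReal ≤ t := by
        rw [inv_mul_le_iff₀ ht0, ← pow_two]; exact e4
      have e9 : t * ∑' l : Λ, ‖inner ℂ (h l) (π.op x g)‖ ^ 2 ≤ t * (c * r) := by gcongr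
      have e10 : 0 ≤ t * (d⁻¹ * c ^ 2 * r) := by positivity
      have e11 : 0 ≤ t * (c * r) := by positivity
      rw [← htb, hb]
      linarith
    have e12 : ‖(r : ℂ) - ∑ l ∈ s, F l x‖ ≤ η := by
      refine le_trans (e2.norm_le_of_bounded (e5.subtype {l : Λ | l ∉ s}).hasSum ?_)
        ((e5.tsum_subtype_le _ {l : Λ | l ∉ s} fun l => ?_).trans e6)
      · rintro ⟨l, hl⟩
        have hlC : x⁻¹ * (l : G) ∉ C := fun hl' => hl ((hsmem l).2 ⟨x, hxK, _, hl', by simp⟩)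
        have := hFuv l x
        rw [huV, ← hwV _ hlC] at this
        exact this
      · have : 0 ≤ v l x := by positivity
        positivity
    have e13 := (Complex.re_le_norm _).trans e12
    simp only [Complex.sub_re, Complex.ofReal_re, Complex.re_sum] at e13
    linarith
  -- integration over `K`
  have hint : (r - η) * μ.real K ≤ ∑ l ∈ s, ∫ x in K, (F l x).re ∂μ := by
    rw [← integral_finsetSum _ fun l _ => (hFire l).integrableOn (s := K)]
    have e1 : ∫ _ in K, (r - η) ∂μ = (r - η) * μ.real K := by
      simp [mul_comm]
    rw [← e1]
    refine setIntegral_mono_on_ae (integrableOn_const hKt)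
      (integrable_finsetSum _ fun l _ => (hFire l).integrableOn) hKm hpt
  -- The integral over `K` is the full integral, known from the orthogonality relations, up to the
  -- integral over `Kᶜ`.
  have hterm : ∀ l, ∫ x in K, (F l x).re ∂μ ≤ d⁻¹ * r * a l + ∫ x in Kᶜ, ‖F l x‖ ∂μ := fun l => by
    have e1 := integral_add_compl hKm (hFire l)
    have e2 : -∫ x in Kᶜ, (F l x).re ∂μ ≤ ∫ x in Kᶜ, ‖F l x‖ ∂μ := by
      rw [← integral_neg]
      refine integral_mono (hFire l).integrableOn.neg (hFi l).norm.integrableOn fun x => ?_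
      exact (neg_le_abs _).trans (Complex.abs_re_le_norm _)
    have e3 := hFint l
    have e4 : ∫ x in K, (F l x).re ∂μ + ∫ x in Kᶜ, (F l x).re ∂μ = ∫ x, (F l x).re ∂μ := e1
    linarith
  have hgood : ∀ l : Λ, (l : G) ∉ Kᶜ * C → ∫ x in Kᶜ, ‖F l x‖ ∂μ ≤ η := fun l hl => by
    have e0 : ∀ x ∈ Kᶜ, x⁻¹ * (l : G) ∉ C := fun x hx hxC => hl ⟨x, hx, _, hxC, by simp⟩
    have e1 : ∫ x in Kᶜ, u l x ∂μ ≤ t ^ 2 := by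
      rw [integral_eq_lintegral_of_nonneg_ae (Eventually.of_forall fun x => by positivity)
        (hui l).aestronglyMeasurable.restrict]
      refine ENNReal.toReal_le_of_le_ofReal (by positivity) (le_trans ?_ hwi)
      rw [← lintegral_inv_mul_eq_self w (l : G)]
      refine le_trans (setLIntegral_mono (hwm.comp (measurable_inv.mul_const (l : G)))
        fun x hx => ?_) (setLIntegral_le_lintegral Kᶜ _)
      rw [huV, ← hwV _ (e0 x hx), ENNReal.ofReal_toReal (hwt _)]
      rfl
    have e2 : ∫ x in Kᶜ, v l x ∂μ ≤ d⁻¹ * c ^ 2 * r :=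
      (setIntegral_le_integral (hvi l) (Eventually.of_forall fun x => by positivity)).trans
        (hvint l)
    have e3 : ∫ x in Kᶜ, ‖F l x‖ ∂μ ≤ ∫ x in Kᶜ, (t⁻¹ * u l x + t * v l x) / 2 ∂μ :=
      integral_mono (hFi l).norm.integrableOn
        ((((hui l).const_mul _).add ((hvi l).const_mul _)).div_const _).integrableOn (hFuv l)
    rw [integral_div, integral_add ((hui l).const_mul _).integrableOn
      ((hvi l).const_mul _).integrableOn, integral_const_mul, integral_const_mul] at e3
    have e4 : t⁻¹ * ∫ x in Kᶜ, u l x ∂μ ≤ t := by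
      rw [inv_mul_le_iff₀ ht0, ← pow_two]; exact e1
    have e5 : t * ∫ x in Kᶜ, v l x ∂μ ≤ t * (d⁻¹ * c ^ 2 * r) := by gcongr
    have e6 : 0 ≤ t * (d⁻¹ * c ^ 2 * r) := by positivity
    have e7 : 0 ≤ t * (c * r) := by positivity
    rw [← htb, hb]
    linarith
  have hall : ∀ l : Λ, ∫ x in Kᶜ, ‖F l x‖ ∂μ ≤ (d⁻¹ * r * r + d⁻¹ * c ^ 2 * r) / 2 := fun l => by
    have e1 : ∫ x in Kᶜ, ‖F l x‖ ∂μ ≤ ∫ x, ‖F l x‖ ∂μ :=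
      setIntegral_le_integral (hFi l).norm (Eventually.of_forall fun x => norm_nonneg _)
    have e2 : ∫ x, ‖F l x‖ ∂μ ≤ ∫ x, (u l x + v l x) / 2 ∂μ :=
      integral_mono (hFi l).norm (((hui l).add (hvi l)).div_const _) (hFuv1 l)
    rw [integral_div, integral_add (hui l) (hvi l), huint] at e2
    have := hvint l
    linarith
  classical
  set bad : Finset Λ := s.filter fun l => (l : G) ∈ Kᶜ * C with hbad
  have hsum : ∑ l ∈ s, ∫ x in K, (F l x).re ∂μ ≤
      -- An index of `s` outside `Kᶜ C` lies in `P` and has error at most `η`; every other index of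
      -- `s` is bad and costs at most `β`. Bad indices in `P` may be counted twice since both bounds
      -- are nonnegative.
      ∑ l ∈ P, (d⁻¹ * r * a l + η) + bad.card * β := by
    have e1 : ∀ l ∈ s, ∫ x in K, (F l x).re ∂μ ≤
        (if l ∈ P then d⁻¹ * r * a l + η else 0) + if (l : G) ∈ Kᶜ * C then β else 0 := by
      intro l hl
      have hda : 0 ≤ d⁻¹ * r * a l := mul_nonneg (by positivity) (ha0 l)
      have hda1 : d⁻¹ * r * a l ≤ d⁻¹ * r := mul_le_of_le_one_right (by positivity) (ha1 l)
      have hP0 : 0 ≤ (if l ∈ P then d⁻¹ * r * a l + η else 0) := by split_ifs <;> linarith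
      by_cases hlb : (l : G) ∈ Kᶜ * C
      · rw [if_pos hlb]
        have := hterm l
        have := hall l
        linarith
      · have hlP : l ∈ P := (hP l).2 (by
          by_contra hlK
          exact hlb ⟨l, hlK, 1, h1C, mul_one _⟩)
        rw [if_neg hlb, if_pos hlP]
        have := hterm l
        have := hgood l hlb
        linarith
    refine (Finset.sum_le_sum e1).trans (le_of_eq ?_)
    rw [Finset.sum_add_distrib, ← Finset.sum_filter, ← Finset.sum_filter, Finset.sum_const,
      nsmul_eq_mul, Finset.filter_mem_eq_inter, Finset.inter_eq_right.2 hPs]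
  have hcard : (bad.card : ℝ) ≤ M.toReal * μ.real ((K * (C * C₀)) ∩ (Kᶜ * (C * C₀))) := by
    have e1 : (bad.card : ℝ≥0∞) = ((Λ ∩ ((K * C) ∩ (Kᶜ * C))).encard : ℝ≥0∞) := by
      have : Λ ∩ ((K * C) ∩ (Kᶜ * C)) = ((↑) : Λ → G) '' (bad : Set Λ) := by
        ext x
        simp only [Set.mem_inter_iff, Set.mem_image, Finset.mem_coe, hbad, Finset.mem_filter, hsmem]
        constructor
        · rintro ⟨hx, hx1, hx2⟩
          exact ⟨⟨x, hx⟩, ⟨hx1, hx2⟩, rfl⟩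
        · rintro ⟨l, ⟨hl1, hl2⟩, rfl⟩
          exact ⟨l.2, hl1, hl2⟩
      rw [this, Subtype.val_injective.encard_image, Set.encard_coe_eq_coe_finsetCard]
      simp
    have e2 : (bad.card : ℝ≥0∞) ≤ M * μ ((K * (C * C₀)) ∩ (Kᶜ * (C * C₀))) := by
      rw [e1]
      refine (hsep _).trans (mul_le_mul_right (measure_mono ?_) M)
      rw [← mul_assoc, ← mul_assoc]
      exact Set.inter_mul_subset
    have e3 : μ ((K * (C * C₀)) ∩ (Kᶜ * (C * C₀))) ≠ ∞ :=
      measure_ne_top_of_subset Set.inter_subset_left (hK.mul (hC.mul hC₀)).measure_lt_top.ne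
    have e4 := ENNReal.toReal_mono (ENNReal.mul_ne_top hM e3) e2
    simpa [Measure.real] using e4
  have e1 : ∑ l ∈ P, (d⁻¹ * r * a l + η) = d⁻¹ * r * ∑ l ∈ P, a l + η * P.card := by
    rw [Finset.sum_add_distrib, ← Finset.mul_sum, Finset.sum_const, nsmul_eq_mul, mul_comm η]
  have e2 := mul_le_mul_of_nonneg_right hcard hβ0
  have e3 := hint.trans hsum
  rw [e1] at e3
  linarith

end Estimate

end ProjectiveRep

/-! ### Polarization and Schur's lemma -/

/-- A function that is sesquilinear over `ℂ` is determined by its diagonal. -/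
theorem sesquilinear_eq_of_diag {H : Type*} [NormedAddCommGroup H] [InnerProductSpace ℂ H]
    {S : H → H → ℂ} (hal : ∀ a b c, S (a + b) c = S a c + S b c)
    (har : ∀ a b c, S a (b + c) = S a b + S a c) (hsl : ∀ (z : ℂ) a b, S (z • a) b = conj z * S a b)
    (hsr : ∀ (z : ℂ) a b, S a (z • b) = z * S a b) {k : ℂ}
    (hdiag : ∀ a, S a a = k * (‖a‖ : ℂ) ^ 2) (a b : H) : S a b = k * inner ℂ a b := by
  have hnorm : ∀ a : H, (‖a‖ : ℂ) ^ 2 = inner ℂ a a := fun a => by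
    rw [inner_self_eq_norm_sq_to_K]; rfl
  have key : ∀ a b : H, (S a b - k * inner ℂ a b) + (S b a - k * inner ℂ b a) = 0 := fun a b => by
    have h1 := hdiag (a + b)
    have ha := hdiag a
    have hb := hdiag b
    rw [hnorm, hal, har, har, inner_add_left, inner_add_right, inner_add_right] at h1
    rw [hnorm] at ha
    rw [hnorm] at hb
    linear_combination h1 - ha - hb
  have h1 := key a b
  have h2 := key a (Complex.I • b)
  rw [hsr, hsl, inner_smul_left, inner_smul_right, Complex.conj_I] at h2
  have h3 : Complex.I * (2 * (S a b - k * inner ℂ a b)) = 0 := by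
    linear_combination h2 + Complex.I * h1
  have h4 := (mul_eq_zero.1 h3).resolve_left Complex.I_ne_zero
  have h5 := (mul_eq_zero.1 h4).resolve_left two_ne_zero
  exact sub_eq_zero.1 h5

namespace ProjectiveRep

section Schur

variable {G H : Type*} [Group G] [MeasurableSpace G]
  [NormedAddCommGroup H] [InnerProductSpace ℂ H] {π : ProjectiveRep G H}

variable (π) in
theorem cocycle_smul_op_one (f : H) : (π.cocycle 1 1 : ℂ) • π.op 1 f = f := by
  have h1 := π.op_mul 1 1 ((π.op 1).symm f)
  rw [mul_one, LinearIsometryEquiv.apply_symm_apply] at h1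
  exact h1.symm

/-- Schur's lemma for bounded self-adjoint operators. -/
theorem IsIrreducible.exists_eq_smul [CompleteSpace H] (hπ : π.IsIrreducible) {P : H →L[ℂ] H}
    (hP : IsSelfAdjoint P) (hcomm : ∀ x f, P (π.op x f) = π.op x (P f)) :
    ∃ c : ℝ, ∀ f, P f = (c : ℂ) • f := by
  by_cases hs : (spectrum ℝ P).Subsingleton
  · obtain ⟨c, hc⟩ : ∃ c, spectrum ℝ P ⊆ {c} := by
      rcases hs.eq_empty_or_singleton with h | ⟨c, h⟩
      · exact ⟨0, by rw [h]; exact Set.empty_subset _⟩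
      · exact ⟨c, h.subset⟩
    refine ⟨c, fun f => ?_⟩
    have h1 := CFC.eq_algebraMap_of_spectrum_subset_singleton P c hc
    rw [h1]
    rfl
  exfalso
  rw [Set.not_subsingleton_iff] at hs
  obtain ⟨α, hα, β, hβ, hαβ⟩ : ∃ α ∈ spectrum ℝ P, ∃ β ∈ spectrum ℝ P, α < β := by
    obtain ⟨α, hα, β, hβ, hne⟩ := hs
    rcases hne.lt_or_gt with h | h
    · exact ⟨α, hα, β, hβ, h⟩
    · exact ⟨β, hβ, α, hα, h⟩
  -- Two spectral points are separated by `γ`: the two cut-off functions give nonzero operators with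
  -- product zero, so the kernel of the first is a closed invariant subspace that is neither zero
  -- nor everything.
  let γ := (α + β) / 2
  let p : ℝ → ℝ := fun t => max 0 (γ - t)
  let q : ℝ → ℝ := fun t => max 0 (t - γ)
  have hp : Continuous p := by fun_prop
  have hq : Continuous q := by fun_prop
  have hpq : cfc p P * cfc q P = 0 := by
    rw [← cfc_mul p q P hp.continuousOn hq.continuousOn]
    have : (fun t => p t * q t) = fun _ => 0 := by
      funext t
      rcases le_total t γ with h | h
      · simp [q, max_eq_left (sub_nonpos.2 h)]
      · simp [p, max_eq_left (sub_nonpos.2 h)]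
    rw [this, cfc_const_zero]
  have hne : ∀ (r : ℝ → ℝ), Continuous r → ∀ t ∈ spectrum ℝ P, r t ≠ 0 → cfc r P ≠ 0 := by
    intro r hr t ht hrt h0
    have h1 := cfc_map_spectrum r P hP hr.continuousOn
    have h2 : r t ∈ spectrum ℝ (cfc r P) := by rw [h1]; exact ⟨t, ht, rfl⟩
    rw [h0] at h2
    rcases subsingleton_or_nontrivial (H →L[ℂ] H) with h | h
    · rw [spectrum.of_subsingleton] at ht
      exact ht
    rw [spectrum.zero_eq] at h2
    exact hrt h2
  have hp0 : cfc p P ≠ 0 := hne p hp α hα (by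
    have : 0 < γ - α := by simp only [γ]; linarith
    exact (lt_max_of_lt_right this).ne')
  have hq0 : cfc q P ≠ 0 := hne q hq β hβ (by
    have : 0 < β - γ := by simp only [γ]; linarith
    exact (lt_max_of_lt_right this).ne')
  have hpc : ∀ x f, cfc p P (π.op x f) = π.op x (cfc p P f) := fun x f => by
    let U : H →L[ℂ] H := ((π.op x).toContinuousLinearEquiv : H →L[ℂ] H)
    have h1 : Commute P U := by
      ext f'
      exact hcomm x f'
    have h2 := hP.commute_cfc h1 p
    exact congrArg (fun L : H →L[ℂ] H => L f) h2
  rcases hπ (cfc p P).ker (cfc p P).isClosed_ker (fun x f hf => by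
    have hf' : cfc p P f = 0 := hf
    change cfc p P (π.op x f) = 0
    rw [hpc, hf', map_zero]) with h | h
  · refine hq0 ?_
    ext f
    have h1 : cfc q P f ∈ (cfc p P).ker := congrArg (fun L : H →L[ℂ] H => L f) hpq
    rw [h] at h1
    exact h1
  · refine hp0 ?_
    ext f
    have h1 : f ∈ (cfc p P).ker := by rw [h]; trivial
    exact h1

/-- Schur's lemma for embedded Hilbert spaces: an invariant Hilbert space norm on a nonzero
subspace is proportional to the given norm, and the subspace is everything. -/
theorem IsIrreducible.exists_norm_sq_eq [CompleteSpace H] (hπ : π.IsIrreducible) {X : Type*}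
    [NormedAddCommGroup X] [InnerProductSpace ℂ X] [CompleteSpace X] (J : X →L[ℂ] H)
    (hJ : Function.Injective J) (hJ0 : J ≠ 0)
    (hinv : ∀ x ξ, ∃ ξ', J ξ' = π.op x (J ξ) ∧ ‖ξ'‖ = ‖ξ‖) :
    Function.Surjective J ∧ ∃ c : ℝ, 0 < c ∧ ∀ ξ, ‖J ξ‖ ^ 2 = c * ‖ξ‖ ^ 2 := by
  choose U hU hUn using hinv
  let L : G → (X →ₗᵢ[ℂ] X) := fun x =>
    { toFun := U x
      map_add' := fun ξ ξ' => hJ (by simp [hU])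
      map_smul' := fun z ξ => hJ (by simp [hU])
      norm_map' := hUn x }
  have hLU : ∀ x ξ, J (L x ξ) = π.op x (J ξ) := hU
  -- The product `π(x) π(x⁻¹)` is a unimodular scalar, which must be compensated. Surjectivity is
  -- what lets the adjoint of `J` commute with the action.
  have hsurj : ∀ x ξ, ∃ ξ', L x ξ' = ξ := fun x ξ => by
    have h1 := π.op_mul x x⁻¹ (J ξ)
    rw [mul_inv_cancel] at h1
    refine ⟨((π.cocycle 1 1 : ℂ) * (π.cocycle x x⁻¹ : ℂ)) • L x⁻¹ ξ, hJ ?_⟩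
    rw [hLU, map_smul, map_smul, hLU]
    rw [mul_smul, ← h1, cocycle_smul_op_one]
  -- Schur's lemma makes `J J*` a scalar `c`; injectivity of `J` then gives `J* J = c`.
  let P : H →L[ℂ] H := J ∘L (ContinuousLinearMap.adjoint J)
  have hPadj : IsSelfAdjoint P := by
    rw [ContinuousLinearMap.isSelfAdjoint_iff']
    simp [P, ContinuousLinearMap.adjoint_comp]
  have hPc : ∀ x f, P (π.op x f) = π.op x (P f) := fun x f => by
    change J (ContinuousLinearMap.adjoint J (π.op x f)) = π.op x (J (ContinuousLinearMap.adjoint J f))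
    rw [← hLU]
    congr 1
    refine ext_inner_right ℂ fun ξ => ?_
    obtain ⟨ξ', rfl⟩ := hsurj x ξ
    rw [ContinuousLinearMap.adjoint_inner_left, LinearIsometry.inner_map_map, hLU,
      LinearIsometryEquiv.inner_map_map, ContinuousLinearMap.adjoint_inner_left]
  obtain ⟨c, hc⟩ := hπ.exists_eq_smul hPadj hPc
  have hc' : ∀ f, J (ContinuousLinearMap.adjoint J f) = (c : ℂ) • f := hc
  obtain ⟨ξ₀, hξ₀⟩ : ∃ ξ, J ξ ≠ 0 := by
    by_contra! h
    exact hJ0 (ContinuousLinearMap.ext h)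
  have hnorm : ∀ ξ, ‖J ξ‖ ^ 2 = c * ‖ξ‖ ^ 2 := fun ξ => by
    have h1 : ContinuousLinearMap.adjoint J (J ξ) = (c : ℂ) • ξ := hJ (by rw [hc', map_smul])
    have h2 : (inner ℂ (J ξ) (J ξ) : ℂ) = (c : ℂ) * inner ℂ ξ ξ := by
      rw [← ContinuousLinearMap.adjoint_inner_right, h1, inner_smul_right]
    rw [inner_self_eq_norm_sq_to_K, inner_self_eq_norm_sq_to_K] at h2
    have h3 : ((‖J ξ‖ ^ 2 : ℝ) : ℂ) = ((c * ‖ξ‖ ^ 2 : ℝ) : ℂ) := by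
      push_cast; exact h2
    exact_mod_cast h3
  have hcpos : 0 < c := by
    have h1 := hnorm ξ₀
    have h2 : 0 < ‖J ξ₀‖ ^ 2 := by positivity
    by_contra! h
    nlinarith [sq_nonneg ‖ξ₀‖]
  refine ⟨fun f => ⟨(c : ℂ)⁻¹ • ContinuousLinearMap.adjoint J f, ?_⟩, c, hcpos, hnorm⟩
  rw [map_smul, hc', smul_smul, inv_mul_cancel₀ (by exact_mod_cast hcpos.ne'), one_smul]

end Schur

end ProjectiveRep

/-! ### Square-integrability and the orthogonality relations -/

namespace ProjectiveRep

section Graph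

variable {G H : Type*} [Group G] [MeasurableSpace G]
  [NormedAddCommGroup H] [InnerProductSpace ℂ H] (π : ProjectiveRep G H)

/-- The graph of `f ↦ V_g f` as an operator into `L²`. -/
noncomputable def coeffGraph (μ : Measure G) (g : H) : Submodule ℂ (WithLp 2 (H × Lp ℂ 2 μ)) where
  carrier := {p | p.snd =ᵐ[μ] π.coeff g p.fst}
  add_mem' := fun {p q} hp hq => by
    refine (Lp.coeFn_add p.snd q.snd).trans ?_
    filter_upwards [hp, hq] with x h1 h2
    rw [Pi.add_apply, h1, h2]
    exact (inner_add_right _ _ _).symm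
  zero_mem' := by
    refine (Lp.coeFn_zero ℂ 2 μ).trans (Eventually.of_forall fun x => ?_)
    exact (inner_zero_right _).symm
  smul_mem' := fun z p hp => by
    refine (Lp.coeFn_smul z p.snd).trans ?_
    filter_upwards [hp] with x h1
    rw [Pi.smul_apply, h1]
    exact (inner_smul_right _ _ _).symm

theorem isClosed_coeffGraph (μ : Measure G) (g : H) :
    IsClosed (π.coeffGraph μ g : Set (WithLp 2 (H × Lp ℂ 2 μ))) := by
  refine IsSeqClosed.isClosed fun p q hp hpq => ?_
  have h1 : Tendsto (fun n => (p n).fst) atTop (𝓝 q.fst) :=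
    ((WithLp.fstL 2 ℂ H (Lp ℂ 2 μ)).continuous.tendsto q).comp hpq
  have h2 : Tendsto (fun n => (p n).snd) atTop (𝓝 q.snd) :=
    ((WithLp.sndL 2 ℂ H (Lp ℂ 2 μ)).continuous.tendsto q).comp hpq
  obtain ⟨ns, hns, hlim⟩ := (tendstoInMeasure_of_tendsto_Lp h2).exists_seq_tendsto_ae
  change q.snd =ᵐ[μ] π.coeff g q.fst
  filter_upwards [hlim, ae_all_iff.2 hp] with x hx hpx
  refine tendsto_nhds_unique hx ?_
  have h3 : Tendsto (fun n => π.coeff g (p (ns n)).fst x) atTop (𝓝 (π.coeff g q.fst x)) :=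
    (tendsto_const_nhds.inner (h1.comp hns.tendsto_atTop))
  exact h3.congr fun n => (hpx (ns n)).symm

theorem norm_coeff_inv (f g : H) (x : G) : ‖π.coeff g f x⁻¹‖ = ‖π.coeff f g x‖ := by
  have h1 := π.norm_inner_op_op x 1 f g
  have h2 : ‖inner ℂ (π.op x f) (π.op 1 g)‖ = ‖inner ℂ (π.op x f) g‖ := by
    conv_rhs => rw [← π.cocycle_smul_op_one g]
    rw [inner_smul_right, norm_mul, Circle.norm_coe, one_mul]
  rw [h2, mul_one] at h1
  exact h1.symm

theorem norm_coeff_op (f g : H) (x y : G) :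
    ‖π.coeff g (π.op x f) y‖ = ‖π.coeff g f (x⁻¹ * y)‖ := by
  have h1 := π.norm_inner_op_op x y f g
  rw [← h1, norm_inner_symm, coeff]

variable {π} {μ : Measure G}

theorem lintegral_enorm_coeff_op [MeasurableMul G] [μ.IsMulLeftInvariant] (f g : H) (x : G) :
    ∫⁻ y, ‖π.coeff g (π.op x f) y‖ₑ ^ 2 ∂μ = ∫⁻ y, ‖π.coeff g f y‖ₑ ^ 2 ∂μ := by
  rw [← lintegral_mul_left_eq_self (fun y => ‖π.coeff g f y‖ₑ ^ 2) x⁻¹]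
  refine lintegral_congr fun y => ?_
  rw [← enorm_norm, norm_coeff_op, enorm_norm]

theorem memLp_coeff_iff (f g : H) :
    MemLp (π.coeff g f) 2 μ ↔ ∫⁻ y, ‖π.coeff g f y‖ₑ ^ 2 ∂μ ≠ ∞ := by
  rw [MemLp, and_iff_right (π.measurable_coeff g f).aestronglyMeasurable,
    eLpNorm_lt_top_iff_lintegral_rpow_enorm_lt_top two_ne_zero ENNReal.ofNat_ne_top,
    lt_top_iff_ne_top]
  simp

/-- If `V_g f ∈ L²` for some nonzero `f`, then `f ↦ V_g f` is a multiple of an isometry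
into `L²`. -/
theorem IsIrreducible.exists_lintegral_coeff_eq [CompleteSpace H]
    [MeasurableMul G] [μ.IsMulLeftInvariant] (hπ : π.IsIrreducible) {g f₀ : H}
    (hf₀ : f₀ ≠ 0) (hgf : MemLp (π.coeff g f₀) 2 μ) :
    ∃ c : ℝ, 0 ≤ c ∧ ∀ f, ∫⁻ y, ‖π.coeff g f y‖ₑ ^ 2 ∂μ = ENNReal.ofReal (c * ‖f‖ ^ 2) := by
  have hsq : ∀ (f : H) (F : Lp ℂ 2 μ), F =ᵐ[μ] π.coeff g f →
      ENNReal.ofReal (‖F‖ ^ 2) = ∫⁻ y, ‖π.coeff g f y‖ₑ ^ 2 ∂μ := fun f F hF => by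
    rw [ENNReal.ofReal_pow (norm_nonneg _), ofReal_norm, Lp.enorm_def,
      eLpNorm_congr_ae hF, eLpNorm_eq_lintegral_rpow_enorm_toReal two_ne_zero ENNReal.ofNat_ne_top,
      ← ENNReal.rpow_natCast, ← ENNReal.rpow_mul]
    simp
  -- Boundedness of `f ↦ V_g f` is not known in advance, but its graph is complete, with an
  -- invariant norm `‖f‖² + ‖V_g f‖²`. Schur's lemma makes this norm proportional to `‖f‖²` and the
  -- domain all of `H`.
  let X := π.coeffGraph μ g
  have : CompleteSpace X := (π.isClosed_coeffGraph μ g).completeSpace_coe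
  let J : X →L[ℂ] H := (WithLp.fstL 2 ℂ H (Lp ℂ 2 μ)) ∘L X.subtypeL
  have hJa : ∀ ξ : X, J ξ = (ξ : WithLp 2 (H × Lp ℂ 2 μ)).fst := fun ξ => rfl
  have hnorm : ∀ ξ : X, ‖ξ‖ ^ 2 = ‖J ξ‖ ^ 2 + ‖(ξ : WithLp 2 (H × Lp ℂ 2 μ)).snd‖ ^ 2 := fun ξ =>
    WithLp.prod_norm_sq_eq_of_L2 (ξ : WithLp 2 (H × Lp ℂ 2 μ))
  have hmk : ∀ f, MemLp (π.coeff g f) 2 μ → ∃ ξ : X, J ξ = f := fun f hf =>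
    ⟨⟨WithLp.toLp 2 (f, hf.toLp _), hf.coeFn_toLp⟩, rfl⟩
  have hxi : ∀ ξ : X, ENNReal.ofReal (‖(ξ : WithLp 2 (H × Lp ℂ 2 μ)).snd‖ ^ 2) =
      ∫⁻ y, ‖π.coeff g (J ξ) y‖ₑ ^ 2 ∂μ := fun ξ => hsq _ _ ξ.2
  have hinj : Function.Injective J := by
    rw [injective_iff_map_eq_zero]
    intro ξ hξ
    have h1 := hxi ξ
    have h2 := hnorm ξ
    simp only [hξ, coeff, inner_zero_right, enorm_zero] at h1
    simp only [ne_eq, OfNat.ofNat_ne_zero, not_false_eq_true, zero_pow, lintegral_const, zero_mul,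
      ENNReal.ofReal_eq_zero] at h1
    rw [hξ, norm_zero] at h2
    have h3 : ‖ξ‖ ^ 2 ≤ 0 := by linarith
    have h4 : ‖ξ‖ = 0 := by
      have := le_antisymm h3 (by positivity)
      simpa using this
    exact norm_eq_zero.1 h4
  obtain ⟨ξ₀, hξ₀⟩ := hmk f₀ hgf
  have hJ0 : J ≠ 0 := fun h => hf₀ (by rw [← hξ₀, h]; rfl)
  obtain ⟨hsurj, c, hc, hcn⟩ := hπ.exists_norm_sq_eq J hinj hJ0 fun x ξ => by
    have h1 : MemLp (π.coeff g (π.op x (J ξ))) 2 μ := by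
      rw [memLp_coeff_iff, lintegral_enorm_coeff_op, ← hxi]
      exact ENNReal.ofReal_ne_top
    obtain ⟨ξ', hξ'⟩ := hmk _ h1
    refine ⟨ξ', hξ', ?_⟩
    have h2 := hxi ξ'
    rw [hξ', lintegral_enorm_coeff_op, ← hxi,
      ENNReal.ofReal_eq_ofReal_iff (by positivity) (by positivity)] at h2
    have h3 := hnorm ξ'
    rw [hξ', LinearIsometryEquiv.norm_map, h2, ← hnorm] at h3
    exact (pow_left_inj₀ (norm_nonneg _) (norm_nonneg _) two_ne_zero).1 h3
  have hle : c ≤ 1 := by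
    have h1 := hcn ξ₀
    have h2 := hnorm ξ₀
    rw [hξ₀] at h1 h2
    have h3 : 0 < ‖f₀‖ ^ 2 := by positivity
    by_contra! h
    nlinarith [sq_nonneg ‖(ξ₀ : WithLp 2 (H × Lp ℂ 2 μ)).snd‖, sq_nonneg ‖ξ₀‖]
  refine ⟨c⁻¹ - 1, sub_nonneg.2 ((one_le_inv₀ hc).2 hle), fun f => ?_⟩
  obtain ⟨ξ, rfl⟩ := hsurj f
  rw [← hxi]
  congr 1
  have h1 := hcn ξ
  have h2 := hnorm ξ
  have h3 : c⁻¹ * ‖J ξ‖ ^ 2 = ‖ξ‖ ^ 2 := by rw [h1]; field_simp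
  linarith

/-- The coefficients of a nonzero vector do not vanish identically. -/
theorem exists_not_ae_eq_zero [CompleteSpace H] [NeZero μ] {f : H} (hf : f ≠ 0) :
    ∃ f', ¬ π.coeff f f' =ᵐ[μ] 0 := by
  by_contra! h
  -- The exceptional null set depends on the functional; strong measurability gives a separable
  -- range, which allows a common one.
  have h1 : (fun x => π.op x f) =ᵐ[μ] 0 := by
    refine ae_eq_zero_of_forall_dual_of_isSeparable ℂ (π.stronglyMeasurable f).isSeparable_range
      (fun L => ?_) (Eventually.of_forall fun x => Set.mem_range_self x)
    filter_upwards [h ((InnerProductSpace.toDual ℂ H).symm L)] with x hx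
    rw [← InnerProductSpace.toDual_symm_apply, ← inner_conj_symm]
    exact (congrArg conj hx).trans (map_zero _)
  obtain ⟨x, hx⟩ := h1.exists
  have h2 := (π.op x).norm_map f
  have hx' : π.op x f = 0 := hx
  rw [hx', norm_zero] at h2
  exact hf (norm_eq_zero.1 h2.symm)

end Graph

section FormalDegree

variable {G H : Type*} [Group G] [TopologicalSpace G] [IsTopologicalGroup G] [T2Space G]
  [LocallyCompactSpace G] [SecondCountableTopology G] [MeasurableSpace G] [BorelSpace G]
  [NormedAddCommGroup H] [InnerProductSpace ℂ H]
  {μ : Measure G} [μ.IsHaarMeasure] {π : ProjectiveRep G H}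

theorem lintegral_enorm_coeff_comm [μ.IsMulRightInvariant] (f g : H) :
    ∫⁻ y, ‖π.coeff g f y‖ₑ ^ 2 ∂μ = ∫⁻ y, ‖π.coeff f g y‖ₑ ^ 2 ∂μ := by
  have := isInvInvariant_of_isMulRightInvariant μ
  rw [← lintegral_inv_eq_self]
  refine lintegral_congr fun y => ?_
  rw [← enorm_norm, norm_coeff_inv, enorm_norm]

/-- Orthogonality relations for discrete series representations of unimodular groups. -/
theorem IsDiscreteSeries.exists_isFormalDegree [CompleteSpace H] [μ.IsMulRightInvariant]
    (hπ : π.IsDiscreteSeries μ) : ∃ d : ℝ, π.IsFormalDegree μ d := by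
  obtain ⟨hirr, g, hg0, hg⟩ := hπ
  obtain ⟨c₀, hc₀, hcg⟩ := hirr.exists_lintegral_coeff_eq hg0 hg
  set k : ℝ := c₀ / ‖g‖ ^ 2 with hk
  have hgn : 0 < ‖g‖ ^ 2 := by positivity
  -- Inversion invariance exchanges `f` and `g`, so `V_f g ∈ L²` for every `f` and `V_f` is also a
  -- multiple of an isometry. Evaluating at `g` identifies its constant.
  have hall : ∀ f f', ∫⁻ y, ‖π.coeff f f' y‖ₑ ^ 2 ∂μ = ENNReal.ofReal (k * ‖f‖ ^ 2 * ‖f'‖ ^ 2) := by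
    intro f f'
    have h1 : ∫⁻ y, ‖π.coeff f g y‖ₑ ^ 2 ∂μ = ENNReal.ofReal (c₀ * ‖f‖ ^ 2) := by
      rw [lintegral_enorm_coeff_comm, hcg]
    obtain ⟨c, hc, hcf⟩ := hirr.exists_lintegral_coeff_eq (g := f) hg0
      ((memLp_coeff_iff g f).2 (by rw [h1]; exact ENNReal.ofReal_ne_top))
    have h2 := hcf g
    rw [h1, ENNReal.ofReal_eq_ofReal_iff (by positivity) (by positivity)] at h2
    have h3 : c = c₀ / ‖g‖ ^ 2 * ‖f‖ ^ 2 := by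
      rw [div_mul_eq_mul_div, h2, mul_div_assoc, div_self hgn.ne', mul_one]
    rw [hcf, hk, h3]
  have hmem : ∀ f f', MemLp (π.coeff f f') 2 μ := fun f f' =>
    (memLp_coeff_iff f' f).2 (by rw [hall]; exact ENNReal.ofReal_ne_top)
  have hk0 : 0 ≤ k := by positivity
  have hkpos : 0 < k := by
    refine lt_of_le_of_ne hk0 fun h => ?_
    obtain ⟨f', hf'⟩ := exists_not_ae_eq_zero (μ := μ) (π := π) hg0
    have h1 := hall g f'
    rw [← h, zero_mul, zero_mul, ENNReal.ofReal_zero,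
      lintegral_eq_zero_iff ((π.measurable_coeff g f').enorm.pow_const 2)] at h1
    refine hf' ?_
    filter_upwards [h1] with x hx
    simpa using hx
  have hint : ∀ f₁ f₂ g₁ g₂ : H,
      Integrable (fun x => inner ℂ (π.op x g₁) f₁ * inner ℂ f₂ (π.op x g₂)) μ := by
    intro f₁ f₂ g₁ g₂
    have h1 := (hmem g₂ f₂).star.integrable_mul (hmem g₁ f₁)
    refine h1.congr (Eventually.of_forall fun x => ?_)
    simp only [Pi.mul_apply, Pi.star_apply, coeff]
    rw [mul_comm, RCLike.star_def, inner_conj_symm]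
  have hdiag : ∀ f g' : H, ∫ x, inner ℂ (π.op x g') f * inner ℂ f (π.op x g') ∂μ =
      ((k * ‖g'‖ ^ 2 : ℝ) : ℂ) * (‖f‖ : ℂ) ^ 2 := by
    intro f g'
    have h2 : ∀ x, inner ℂ (π.op x g') f * inner ℂ f (π.op x g') =
        ((‖π.coeff g' f x‖ ^ 2 : ℝ) : ℂ) := fun x => by
      rw [← inner_conj_symm f, RCLike.mul_conj, coeff]; norm_cast
    simp only [h2]
    rw [integral_complex_ofReal, integral_eq_lintegral_of_nonneg_ae
      (Eventually.of_forall fun x => by positivity)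
      ((π.measurable_coeff g' f).norm.pow_const 2).aestronglyMeasurable]
    have h3 : ∫⁻ x, ENNReal.ofReal (‖π.coeff g' f x‖ ^ 2) ∂μ = ∫⁻ y, ‖π.coeff g' f y‖ₑ ^ 2 ∂μ :=
      lintegral_congr fun x => by rw [← ofReal_norm, ENNReal.ofReal_pow (norm_nonneg _)]
    rw [h3, hall, ENNReal.toReal_ofReal (by positivity)]
    push_cast
    ring
  have hdiag₂ : ∀ f₁ f₂ g' : H, ∫ x, inner ℂ (π.op x g') f₁ * inner ℂ f₂ (π.op x g') ∂μ =
      ((k * ‖g'‖ ^ 2 : ℝ) : ℂ) * inner ℂ f₂ f₁ := by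
    intro f₁ f₂ g'
    refine sesquilinear_eq_of_diag
      (S := fun a b => ∫ x, inner ℂ (π.op x g') b * inner ℂ a (π.op x g') ∂μ)
      (fun a b c => ?_) (fun a b c => ?_) (fun z a b => ?_) (fun z a b => ?_)
      (fun a => hdiag a g') f₂ f₁
    · rw [← integral_add (hint _ _ _ _) (hint _ _ _ _)]
      simp only [inner_add_left, mul_add]
    · rw [← integral_add (hint _ _ _ _) (hint _ _ _ _)]
      simp only [inner_add_right, add_mul]
    · rw [← integral_const_mul]
      simp only [inner_smul_left, mul_left_comm]
    · rw [← integral_const_mul]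
      simp only [inner_smul_right, mul_assoc]
  refine ⟨k⁻¹, inv_pos.2 hkpos, fun f₁ f₂ g₁ g₂ => ⟨hint _ _ _ _, ?_⟩⟩
  -- Second polarization, now in the window vectors; the first was in the analysed vectors.
  have h := sesquilinear_eq_of_diag (k := (k : ℂ) * inner ℂ f₂ f₁)
      (S := fun a b => ∫ x, inner ℂ (π.op x a) f₁ * inner ℂ f₂ (π.op x b) ∂μ)
      (fun a b c => ?_) (fun a b c => ?_) (fun z a b => ?_) (fun z a b => ?_)
      (fun a => ?_) g₁ g₂
  · rw [inner_conj_symm]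
    simpa using h
  · rw [← integral_add (hint _ _ _ _) (hint _ _ _ _)]
    simp only [map_add, inner_add_left, add_mul]
  · rw [← integral_add (hint _ _ _ _) (hint _ _ _ _)]
    simp only [map_add, inner_add_right, mul_add]
  · rw [← integral_const_mul]
    simp only [map_smul, inner_smul_left, mul_assoc]
  · rw [← integral_const_mul]
    simp only [map_smul, inner_smul_right, mul_left_comm]
  · rw [hdiag₂]
    push_cast
    ring

end FormalDegree

end ProjectiveRep

theorem IsFrame.comp_equiv {H : Type*} [NormedAddCommGroup H] [InnerProductSpace ℂ H]
    {ι κ : Type*} {v : ι → H} (hv : IsFrame v) (e : κ ≃ ι) : IsFrame (v ∘ e) := by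
  obtain ⟨A, B, hA, hB, h⟩ := hv
  refine ⟨A, B, hA, hB, fun f => ?_⟩
  have h1 : ∑' i, ‖inner ℂ ((v ∘ e) i) f‖ ^ 2 = ∑' i, ‖inner ℂ (v i) f‖ ^ 2 :=
    e.tsum_eq fun i => ‖inner ℂ (v i) f‖ ^ 2
  rw [h1]
  exact ⟨e.summable_iff.2 (h f).1, (h f).2⟩

namespace ProjectiveRep

/-- The default value `0` of `formalDegree` does not occur for a discrete series. -/
theorem IsDiscreteSeries.isFormalDegree_formalDegree {G H : Type*} [Group G] [TopologicalSpace G]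
    [IsTopologicalGroup G] [T2Space G] [LocallyCompactSpace G] [SecondCountableTopology G]
    [MeasurableSpace G] [BorelSpace G] [NormedAddCommGroup H] [InnerProductSpace ℂ H]
    [CompleteSpace H] {μ : Measure G} [μ.IsHaarMeasure] [μ.IsMulRightInvariant]
    {π : ProjectiveRep G H} (hπ : π.IsDiscreteSeries μ) :
    π.IsFormalDegree μ (π.formalDegree μ) := by
  have h := hπ.exists_isFormalDegree
  rw [formalDegree, dif_pos h]
  exact h.choose_spec

/-- The index set of a coherent frame is relatively separated. -/
theorem exists_encard_le_of_isFrame {G H : Type*} [Group G] [TopologicalSpace G]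
    [IsTopologicalGroup G] [T2Space G] [LocallyCompactSpace G] [SecondCountableTopology G]
    [MeasurableSpace G] [BorelSpace G] [NormedAddCommGroup H] [InnerProductSpace ℂ H]
    {μ : Measure G} [μ.IsHaarMeasure] [μ.IsMulRightInvariant]
    {π : ProjectiveRep G H} {Λ : Set G} (hΛ : Λ.Countable) {g : H} (hg0 : g ≠ 0)
    (hframe : IsFrame (π.coherentSystem Λ g)) :
    ∃ C : Set G, IsCompact C ∧ ∃ M : ℝ≥0∞, M ≠ ∞ ∧
      ∀ S : Set G, ((Λ ∩ S).encard : ℝ≥0∞) ≤ M * μ (S * C) := by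
  have hinv := isInvInvariant_of_isMulRightInvariant μ
  have : Countable Λ := hΛ
  obtain ⟨A, B, hA, hB, hAB⟩ := hframe
  have hφ : ∀ x (l : Λ), ‖π.coeff g g (x⁻¹ * l)‖ = ‖inner ℂ (π.coherentSystem Λ g l) (π.op x g)‖ :=
    fun x l => by rw [← norm_inner_op_op, norm_inner_symm, coherentSystem]
  refine exists_encard_le_measure_mul (φ := fun y => ‖π.coeff g g y‖ₑ ^ 2)
    (b := ENNReal.ofReal ((‖g‖ * ‖g‖) ^ 2)) (N := ENNReal.ofReal (B * ‖g‖ ^ 2)) hΛ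
    ((π.measurable_coeff g g).enorm.pow_const 2) ENNReal.ofReal_ne_top (fun x => ?_)
    ENNReal.ofReal_ne_top (fun x => ?_) fun h0 => ?_
  · rw [← ofReal_norm, ← ENNReal.ofReal_pow (norm_nonneg _)]
    refine ENNReal.ofReal_le_ofReal (pow_le_pow_left₀ (norm_nonneg _) ?_ 2)
    refine (norm_inner_le_norm _ _).trans ?_
    rw [LinearIsometryEquiv.norm_map]
  · have h1 : ∀ l : Λ, ‖π.coeff g g (x⁻¹ * l)‖ₑ ^ 2 =
        ENNReal.ofReal (‖inner ℂ (π.coherentSystem Λ g l) (π.op x g)‖ ^ 2) := fun l => by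
      rw [← ofReal_norm, hφ, ENNReal.ofReal_pow (norm_nonneg _)]
    simp only [h1]
    rw [← ENNReal.ofReal_tsum_of_nonneg (fun l => by positivity) (hAB _).1]
    refine ENNReal.ofReal_le_ofReal ((hAB _).2.2.trans ?_)
    rw [LinearIsometryEquiv.norm_map]
  -- If `V_g g` vanished almost everywhere, some `π(x) g` would have all frame coefficients zero,
  -- against the lower frame bound.
  · have h1 : ∀ᵐ x ∂μ, ∀ l : Λ, ‖π.coeff g g (x⁻¹ * l)‖ₑ ^ 2 = 0 := ae_all_iff.2 fun l =>
      ((measurePreserving_mul_right μ (l : G)).comp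
        (Measure.measurePreserving_inv μ)).quasiMeasurePreserving.ae h0
    obtain ⟨x, hx⟩ := h1.exists
    have h2 := (hAB (π.op x g)).2.1
    have h3 : ∀ l : Λ, ‖inner ℂ (π.coherentSystem Λ g l) (π.op x g)‖ = 0 := fun l => by
      rw [← hφ]
      simpa using hx l
    simp only [h3, LinearIsometryEquiv.norm_map] at h2
    have h4 : 0 < A * ‖g‖ ^ 2 := by positivity
    simp at h2
    linarith

end ProjectiveRep

end CoherentFrame

/-! ### Comparison of the two bounds along the Folner sequence -/

theorem proposition4p3 {G H : Type*}
    [Group G] [TopologicalSpace G] [IsTopologicalGroup G] [T2Space G] [LocallyCompactSpace G]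
    [SecondCountableTopology G] [MeasurableSpace G] [BorelSpace G]
    [NormedAddCommGroup H] [InnerProductSpace ℂ H] [CompleteSpace H]
    -- a Haar measure of the unimodular group `G`
    (μ : Measure G) [μ.IsHaarMeasure] [μ.IsMulRightInvariant]
    -- the compact symmetric unit neighbourhood used for local maximal functions
    (Q : Set G) (hQ : IsCompact Q) (hQ_symm : Q⁻¹ = Q) (hQ_nhds : Q ∈ 𝓝 (1 : G))
    (π : CoherentFrame.ProjectiveRep G H) (hπ : π.IsDiscreteSeries μ)
    (Λ : Set G) (hΛ : DiscreteTopology Λ)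
    (g : H) (hg : g ∈ π.B2 μ Q)
    (hframe : CoherentFrame.IsFrame (π.coherentSystem Λ g))
    -- `G` is amenable, and both densities may be computed along arbitrary, possibly different,
    -- strong Folner sequences
    (K K' : ℕ → Set G) (hK : CoherentFrame.IsStrongFolner μ K)
    (hK' : CoherentFrame.IsStrongFolner μ K')
    (hremove : ∃ Γ : Set G, Γ ⊆ Λ ∧ 0 < CoherentFrame.lowerBeurlingDensity μ K Γ ∧
      CoherentFrame.IsFrame (π.coherentSystem (Λ \ Γ) g)) :
    ENNReal.ofReal (π.formalDegree μ) < CoherentFrame.upperBeurlingDensity μ K' Λ := by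
  obtain ⟨Γ, hΓΛ, hΓ, hΓframe⟩ := hremove
  have hd := hπ.isFormalDegree_formalDegree
  set d := π.formalDegree μ
  have hd0 : 0 < d := hd.1
  have hg0 : g ≠ 0 := by
    rintro rfl
    obtain ⟨f, hf, -⟩ := hπ.2
    obtain ⟨A, B, hA, hB, hAB⟩ := hframe
    have h1 := (hAB f).2.1
    have h2 : 0 < A * ‖f‖ ^ 2 := by positivity
    simp [CoherentFrame.ProjectiveRep.coherentSystem] at h1
    linarith
  have hcount : Countable Λ := TopologicalSpace.separableSpace_iff_countable.1 inferInstance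
  have hΛc : Λ.Countable := hcount
  obtain ⟨C₀, hC₀, M, hM, hsep⟩ :=
    CoherentFrame.ProjectiveRep.exists_encard_le_of_isFrame (μ := μ) hΛc hg0 hframe
  obtain ⟨c, hc0, hcΓ⟩ := CoherentFrame.eventually_mul_measure_le_encard (hΛc.mono hΓΛ) hC₀ hM
    (fun S => le_trans (ENat.toENNReal_le.2
      (Set.encard_le_encard (Set.inter_subset_inter_left S hΓΛ))) (hsep S)) hK hK' hΓ
  set r := ‖g‖ ^ 2 with hr
  have hr0 : 0 < r := by positivity
  set s : Set Λ := {l | (l : G) ∈ Γ} with hs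
  let e : (sᶜ : Set Λ) ≃ ↥(Λ \ Γ) :=
    { toFun := fun l => ⟨l, l.1.2, l.2⟩
      invFun := fun l => ⟨⟨l, l.2.1⟩, l.2.2⟩
      left_inv := fun l => rfl
      right_inv := fun l => rfl }
  obtain ⟨h, a, b, ε, hb, hε, hrec, hbes, hha, hhn, ha0, ha1, has⟩ :=
    hframe.exists_dual_lt_one (s := s) (r := r) (hΓframe.comp_equiv e)
      (fun l => by rw [CoherentFrame.ProjectiveRep.coherentSystem, LinearIsometryEquiv.norm_map]) hr0
  -- finiteness of the index sets
  have hKc : ∀ n, IsCompact (K' n) := hK'.isCompact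
  have hfin : ∀ n, {l : Λ | (l : G) ∈ K' n}.Finite := fun n => by
    have h1 : (Λ ∩ K' n).encard ≠ ⊤ := fun htop => by
      have h2 := hsep (K' n)
      rw [htop] at h2
      exact (ENNReal.mul_ne_top hM ((hKc n).mul hC₀).measure_lt_top.ne) (top_le_iff.1 h2)
    refine Set.Finite.of_finite_image (f := ((↑) : Λ → G))
      ((Set.encard_ne_top_iff.1 h1).subset ?_) Subtype.val_injective.injOn
    rintro _ ⟨l, hl, rfl⟩
    exact ⟨l.2, hl⟩
  let P : ℕ → Finset Λ := fun n => (hfin n).toFinset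
  have hP : ∀ n l, l ∈ P n ↔ (l : G) ∈ K' n := fun n l => by simp [P]
  have hPcard : ∀ n, ((P n).card : ℝ≥0∞) = ((Λ ∩ K' n).encard : ℝ≥0∞) := fun n => by
    have : Λ ∩ K' n = ((↑) : Λ → G) '' (P n : Set Λ) := by
      ext x
      simp only [Set.mem_inter_iff, Set.mem_image, Finset.mem_coe, hP]
      exact ⟨fun hx => ⟨⟨x, hx.1⟩, hx.2, rfl⟩, fun ⟨l, hl, hlx⟩ => hlx ▸ ⟨l.2, hl⟩⟩
    rw [this, Subtype.val_injective.encard_image, Set.encard_coe_eq_coe_finsetCard]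
    simp
  classical
  have hΓcard : ∀ n, (((P n).filter (· ∈ s)).card : ℝ≥0∞) = ((Γ ∩ K' n).encard : ℝ≥0∞) := fun n => by
    have : Γ ∩ K' n = ((↑) : Λ → G) '' (((P n).filter (· ∈ s) : Finset Λ) : Set Λ) := by
      ext x
      simp only [Set.mem_inter_iff, Set.mem_image, Finset.mem_coe, Finset.mem_filter, hP, hs,
        Set.mem_ofPred_eq]
      exact ⟨fun hx => ⟨⟨x, hΓΛ hx.1⟩, ⟨hx.2, hx.1⟩, rfl⟩, fun ⟨l, hl, hlx⟩ => hlx ▸ ⟨hl.2, hl.1⟩⟩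
    rw [this, Subtype.val_injective.encard_image, Set.encard_coe_eq_coe_finsetCard]
    simp
  -- a real lower bound for the density of `Γ`
  obtain ⟨c', hc'0, hc'⟩ : ∃ c' : ℝ, 0 < c' ∧
      ∀ᶠ n in atTop, c' * μ.real (K' n) ≤ ((P n).filter (· ∈ s)).card := by
    -- The constant `c` is only known to be nonzero; truncating at `1` makes it finite for the
    -- passage to real numbers.
    have hmin : min c 1 ≠ ∞ := ne_top_of_le_ne_top ENNReal.one_ne_top (min_le_right _ _)
    refine ⟨(min c 1).toReal, ENNReal.toReal_pos (by simp [hc0]) hmin, ?_⟩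
    filter_upwards [hcΓ] with n hn
    rw [← hΓcard] at hn
    have h1 : min c 1 * μ (K' n) ≤ (((P n).filter (· ∈ s)).card : ℝ≥0∞) :=
      (mul_le_mul_left (min_le_left _ _) _).trans hn
    have h2 := ENNReal.toReal_mono (ENNReal.natCast_ne_top _) h1
    simpa [Measure.real] using h2
  by_contra! hcon
  have hsum : ∀ n, ∑ l ∈ P n, a l ≤ (P n).card - ε * ((P n).filter (· ∈ s)).card := fun n => by
    have h1 : ∀ l ∈ P n, a l ≤ 1 - if l ∈ s then ε else 0 := fun l _ => by
      split_ifs with hl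
      · exact has l hl
      · rw [sub_zero]; exact ha1 l
    refine (Finset.sum_le_sum h1).trans (le_of_eq ?_)
    rw [Finset.sum_sub_distrib, ← Finset.sum_filter]
    simp [mul_comm]
  -- `τ` is the gain per unit measure. The excess `δ` over `d` uses up half of it; `η` is chosen so
  -- that all `η` terms together cost `τ / 8`, and the boundary costs another `τ / 8`, leaving a
  -- strict contradiction.
  set τ := d⁻¹ * r * (ε * c') with hτ
  have hτ0 : 0 < τ := by positivity
  set δ := ε * c' / 2 with hδ
  have hδ0 : 0 < δ := by positivity
  set η := τ / (8 * (1 + d + δ)) with hη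
  have hη0 : 0 < η := by positivity
  obtain ⟨D, hD, R, hR, hmain⟩ := hd.exists_mul_measure_le hQ hQ_symm hQ_nhds hg hΛc hC₀ hM hsep hb
    hrec hbes hha hhn ha0 ha1 hη0
  have hcardle : ∀ᶠ n in atTop, ((P n).card : ℝ) ≤ (d + δ) * μ.real (K' n) := by
    have h1 : CoherentFrame.upperBeurlingDensity μ K' Λ < ENNReal.ofReal (d + δ) :=
      hcon.trans_lt ((ENNReal.ofReal_lt_ofReal_iff (by positivity)).2 (by linarith))
    filter_upwards [eventually_lt_of_limsup_lt h1] with n hn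
    -- Only the untranslated sets, `x = 1`, are needed from the supremum.
    have h2 := (le_iSup (fun x : G => ((Λ ∩ x • K' n).encard : ℝ≥0∞) / μ (K' n)) 1).trans hn.le
    simp only [one_smul] at h2
    rw [ENNReal.div_le_iff (hK'.measure_ne_zero n) (hKc n).measure_lt_top.ne, ← hPcard] at h2
    have h3 := ENNReal.toReal_mono
      (ENNReal.mul_ne_top ENNReal.ofReal_ne_top (hKc n).measure_lt_top.ne) h2
    rw [ENNReal.toReal_mul, ENNReal.toReal_ofReal (by positivity)] at h3
    simpa [Measure.real] using h3
  have hbdry : ∀ᶠ n in atTop, R * μ.real ((K' n * D) ∩ ((K' n)ᶜ * D)) ≤ τ / 8 * μ.real (K' n) := by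
    have h1 := hK'.tendsto_boundary D hD
    have h2 : 0 < ENNReal.ofReal (τ / 8 / (R + 1)) := ENNReal.ofReal_pos.2 (by positivity)
    filter_upwards [h1.eventually_lt_const h2] with n hn
    have h3 := (ENNReal.div_le_iff (hK'.measure_ne_zero n) (hKc n).measure_lt_top.ne).1 hn.le
    have h4 := ENNReal.toReal_mono
      (ENNReal.mul_ne_top ENNReal.ofReal_ne_top (hKc n).measure_lt_top.ne) h3
    rw [ENNReal.toReal_mul, ENNReal.toReal_ofReal (by positivity)] at h4
    have h5 : R * (τ / 8 / (R + 1)) ≤ τ / 8 := by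
      rw [mul_div_assoc', div_le_iff₀ (by positivity)]
      nlinarith
    calc R * μ.real ((K' n * D) ∩ ((K' n)ᶜ * D)) ≤ R * (τ / 8 / (R + 1) * μ.real (K' n)) :=
          mul_le_mul_of_nonneg_left h4 hR
      _ = R * (τ / 8 / (R + 1)) * μ.real (K' n) := (mul_assoc _ _ _).symm
      _ ≤ τ / 8 * μ.real (K' n) := mul_le_mul_of_nonneg_right h5 measureReal_nonneg
  obtain ⟨n, hn1, hn2, hn3⟩ := (hc'.and (hcardle.and hbdry)).exists
  have hm0 : 0 < μ.real (K' n) :=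
    ENNReal.toReal_pos (hK'.measure_ne_zero n) (hKc n).measure_lt_top.ne
  have h1 := hmain (K' n) (hKc n) (P n) (hP n)
  set m := μ.real (K' n)
  have h2 : d⁻¹ * r * ∑ l ∈ P n, a l ≤ d⁻¹ * r * ((d + δ) * m - ε * (c' * m)) := by
    refine mul_le_mul_of_nonneg_left ((hsum n).trans ?_) (by positivity)
    have := mul_le_mul_of_nonneg_left hn1 hε.le
    linarith
  have h3 : d⁻¹ * r * ((d + δ) * m - ε * (c' * m)) = r * m - τ / 2 * m := by
    rw [hτ, hδ]; field_simp; ring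
  have h4 : η * (P n).card ≤ η * ((d + δ) * m) := mul_le_mul_of_nonneg_left hn2 hη0.le
  have h5 : η * (1 + d + δ) = τ / 8 := by rw [hη]; field_simp
  have h6 : η * m + η * ((d + δ) * m) = τ / 8 * m := by rw [← h5]; ring
  have h7 : 0 < τ * m := by positivity
  rw [h3] at h2
  linarith
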